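/- Let $H$ be a complex Hilbert space with inner product $(\cdot,\cdot)$, linear in the first argument. Operators in $H$ are linear maps defined on subspaces; sums and products of operators have their natural domains, and $\mathrm{dom}$, $\mathrm{ran}$ denote domain and range. An operator $A$ is *$m$-accretive* if it is densely defined, $\mathrm{Re}(Au,u)\ge 0$ for all $u\in\mathrm{dom}\,A$, and $\mathrm{ran}(A-\lambda I)=H$ for some $\lambda$ with $\mathrm{Re}\,\lambda<0$. It is *$m$-sectorial* if in addition, for some $\alpha\in[0,\pi/2)$, $|\mathrm{Im}(Au,u)|\le\tan\alpha\,\mathrm{Re}(Au,u)$ for all $u\in\mathrm{dom}\,A$. For $m$-accretive $A$ let $A^{1/2}$ be its $m$-accretive square root, i.e. $A^{1/2}=(I-T)^{1/2}\big((I+T)^{1/2}\big)^{-1}$ with the contraction $T=(I-A)(I+A)^{-1}$ and $(I\pm T)^{1/2}=\sum_{n\ge0}\binom{1/2}{n}(\pm T)^n$. For a bounded operator $T$ on $H$ put $\mathrm{Re}\,T=\frac12(T+T^*)$ and $\mathrm{Im}\,T=\frac1{2i}(T-T^*)$. "Bounded inverse" means a bounded inverse defined on all of $H$. Let $B$ be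 an unbounded $m$-accretive operator in $H$ having bounded inverse. Write $B^{-1/2}=(B^{1/2})^{-1}$, $B^{*1/2}=(B^*)^{1/2}$, $B^{*-1/2}=(B^{*1/2})^{-1}$, and let $$Z=i\,\big(\mathrm{Re}\,B^{-1/2}\big)^{-1}\,\mathrm{Im}\,B^{-1/2}.$$ **(1)** The following are equivalent: - (i) $\mathrm{dom}\,B^{1/2}=\mathrm{dom}\,B^{*1/2}$; - (ii) the operator $B^{1/2}B^{*-1/2}$ is bounded and has bounded inverse; - (iii) $\mathrm{ran}(I+Z)=\mathrm{ran}(I-Z)=H$; - (iv) $\mathrm{ran}(I-Z^2)=H$; - (v) $\mathrm{dom}\,(\mathrm{Re}\,B^{-1/2})^{-1}\subseteq\mathrm{dom}\,B^{1/2}\cap\mathrm{dom}\,B^{*1/2}$. **(2)** Suppose moreover that $B$ is $m$-sectorial. Let $\mathfrak b$ be the closed sectorial form associated with $B$, i.e. the closed sectorial form which has $\mathrm{dom}\,B$ as a core and satisfies $\mathfrak b[u,v]=(Bu,v)$ for $u\in\mathrm{dom}\,B$, $v\in\mathrm{dom}\,\mathfrak b$. Let $B_R$ be the nonnegative selfadjoint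 operator associated with the form $\mathfrak b_R[u,v]=\frac12\big(\mathfrak b[u,v]+\overline{\mathfrak b[v,u]}\big)$: $u\in\mathrm{dom}\,B_R$ and $B_Ru=w$ if and only if $u\in\mathrm{dom}\,\mathfrak b$ and $\mathfrak b_R[u,v]=(w,v)$ for all $v\in\mathrm{dom}\,\mathfrak b$. Then the following are equivalent: - (a) $\mathrm{dom}\,B^{1/2}=\mathrm{dom}\,B^{*1/2}$; - (b) $\mathrm{dom}\,B^{1/2}=\mathrm{dom}\,B_R^{1/2}$; - (c) $\mathrm{dom}\,B^{*1/2}=\mathrm{dom}\,B_R^{1/2}$; - (d) $\mathrm{dom}\,B^{1/2}\subseteq\mathrm{dom}\,B_R^{1/2}$ and $\mathrm{dom}\,B^{*1/2}\subseteq\mathrm{dom}\,B_R^{1/2}$; - (e) $\mathrm{dom}\,B_R^{1/2}\subseteq\mathrm{dom}\,B^{1/2}\cap\mathrm{dom}\,B^{*1/2}$; - (f) $\|Z\|<1$; - (g) $\displaystyle\sup_{f\in H\setminus\{0\}}\frac{\|(\mathrm{Re}\,B^{-1/2})f\|^2}{\mathrm{Re}(B^{-1}f,f)}<\infty$; - (h)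 $\displaystyle\sup_{f\in H\setminus\{0\}}\frac{\|B^{*-1/2}f\|^2+\|B^{-1/2}f\|^2}{\mathrm{Re}(B^{-1}f,f)}<\infty$; - (i) $\mathrm{dom}\,(\mathrm{Re}\,B^{-1/2})^{-1}=\mathrm{dom}\,\big((\mathrm{Re}\,B^{-1})^{1/2}\big)^{-1}$, with the nonnegative square root of the bounded nonnegative operator $\mathrm{Re}\,B^{-1}$. -/

import Mathlib

noncomputable section

namespace KatoSquareRoot

variable {H : Type*} [NormedAddCommGroup H] [InnerProductSpace ℂ H]

/-! ### Unbounded operators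

A linear operator in `H` is a `LinearPMap`, that is, a linear map defined on a subspace of `H`.
The inner product `(x, y)` that is linear in `x` is `inner ℂ y x` in Mathlib. -/

/-- An everywhere defined bounded operator, seen as an operator with domain `H`. -/
def ofBounded (T : H →L[ℂ] H) : H →ₗ.[ℂ] H := T.toLinearMap.toPMap ⊤

/-- The identity operator. -/
def idOp : H →ₗ.[ℂ] H := ofBounded (ContinuousLinearMap.id ℂ H)

/-- The product `S T` of two operators, on its natural domain
`{x ∈ dom T : T x ∈ dom S}`. -/
def opMul (S T : H →ₗ.[ℂ] H) : H →ₗ.[ℂ] H where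
  domain := (S.domain.comap T.toFun).map T.domain.subtype
  toFun :=
    { toFun := fun x => S ⟨T ⟨x, by
          obtain ⟨y, _, hy⟩ := x.2; exact hy ▸ y.2⟩, by
          obtain ⟨x, y, hm, rfl⟩ := x; exact hm⟩
      map_add' := fun x y => by
        rw [← LinearPMap.map_add]; congr 1
        ext; simp only [Submodule.coe_add]; rw [← LinearPMap.map_add]; rfl
      map_smul' := fun c x => by
        rw [RingHom.id_apply, ← LinearPMap.map_smul]; congr 1
        ext; simp only [Submodule.coe_smul]; rw [← LinearPMap.map_smul]; rfl }

/-- The range of an operator. -/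
def ran (A : H →ₗ.[ℂ] H) : Submodule ℂ H := LinearMap.range A.toFun

/-- The norm `sup {‖A x‖ : x ∈ dom A, ‖x‖ ≤ 1}` of an operator, as an element of `[0, ∞]`. -/
def opNorm (A : H →ₗ.[ℂ] H) : ENNReal := ⨆ (x : A.domain) (_ : ‖x‖ ≤ 1), ‖A x‖ₑ

/-- An operator is bounded if its norm is finite. -/
def IsBoundedOp (A : H →ₗ.[ℂ] H) : Prop := opNorm A < ⊤

/-- The bounded operator `S`, defined on the whole space, is the inverse of the operator `A`. -/
def IsBoundedInverse (A : H →ₗ.[ℂ] H) (S : H →L[ℂ] H) : Prop :=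
  (∀ y : H, (S y, y) ∈ A.graph) ∧ ∀ x : A.domain, S (A x) = x

/-- `A` has a bounded inverse, defined on the whole space. -/
def HasBoundedInverse (A : H →ₗ.[ℂ] H) : Prop := ∃ S : H →L[ℂ] H, IsBoundedInverse A S

open Classical in
/-- The bounded operator `A⁻¹` (with the default value `0` if `A` has no bounded inverse). -/
def boundedInv (A : H →ₗ.[ℂ] H) : H →L[ℂ] H :=
  if h : HasBoundedInverse A then h.choose else 0

/-! ### Accretive and sectorial operators -/

/-- `Re (A u, u) ≥ 0` for all `u ∈ dom A`. -/
def IsAccretive (A : H →ₗ.[ℂ] H) : Prop :=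
  ∀ u : A.domain, 0 ≤ (inner ℂ (u : H) (A u)).re

/-- `A` is `m`-accretive: it is accretive, densely defined, and `ran (A - λ I) = H` for some
`λ` with `Re λ < 0`. -/
def IsMAccretive (A : H →ₗ.[ℂ] H) : Prop :=
  IsAccretive A ∧ Dense (A.domain : Set H) ∧
    ∃ l : ℂ, l.re < 0 ∧ ran (A - l • idOp) = ⊤

/-- `A` is `m`-`α`-sectorial for some semi-angle `α ∈ [0, π/2)`. -/
def IsMSectorial (A : H →ₗ.[ℂ] H) : Prop :=
  IsMAccretive A ∧ ∃ α : ℝ, 0 ≤ α ∧ α < Real.pi / 2 ∧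
    ∀ u : A.domain, |(inner ℂ (u : H) (A u)).im| ≤ Real.tan α * (inner ℂ (u : H) (A u)).re

/-! ### The square root of an `m`-accretive operator -/

/-- The Cayley transform `T = (I - A)(I + A)⁻¹ = 2 (I + A)⁻¹ - I`, which is a contraction if
`A` is `m`-accretive. -/
def cayley (A : H →ₗ.[ℂ] H) : H →L[ℂ] H :=
  (2 : ℂ) • boundedInv (idOp + A) - ContinuousLinearMap.id ℂ H

/-- The square root `(I + T)^(1/2)`, for a contraction `T`, given by the binomial series
`∑ n, (1/2 choose n) T ^ n`, which converges absolutely in the operator norm. -/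
def sqrtOneAdd (T : H →L[ℂ] H) : H →L[ℂ] H := ∑' n : ℕ, Ring.choose (1 / 2 : ℝ) n • T ^ n

/-- The square root `A^(1/2) = (I - T)^(1/2) ((I + T)^(1/2))⁻¹` of an `m`-accretive operator `A`,
where `T` is the Cayley transform of `A`. It is the unique `m`-accretive operator with
square `A`. -/
def sqrtOp (A : H →ₗ.[ℂ] H) : H →ₗ.[ℂ] H :=
  opMul (ofBounded (sqrtOneAdd (-cayley A))) (ofBounded (sqrtOneAdd (cayley A))).inverse

/-! ### Sesquilinear forms -/

/-- A sesquilinear form `a[u, v]` on a subspace of `H`, linear in `u` and antilinear in `v`. -/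
structure SesqForm (H : Type*) [NormedAddCommGroup H] [InnerProductSpace ℂ H] where
  domain : Submodule ℂ H
  form : domain →ₗ[ℂ] domain →ₗ⋆[ℂ] ℂ

namespace SesqForm

/-- `a` is sectorial, with vertex `0` and some semi-angle `α ∈ [0, π/2)`. -/
def IsSectorial (a : SesqForm H) : Prop :=
  ∃ α : ℝ, 0 ≤ α ∧ α < Real.pi / 2 ∧ ∀ u : a.domain,
    0 ≤ (a.form u u).re ∧ |(a.form u u).im| ≤ Real.tan α * (a.form u u).re

/-- `a` is closed: if `u n ∈ dom a`, `u n → u` in `H` and `a[u n - u m, u n - u m] → 0`, then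
`u ∈ dom a` and `a[u n - u, u n - u] → 0`. -/
def IsClosed (a : SesqForm H) : Prop :=
  ∀ (x : ℕ → a.domain) (u : H),
    Filter.Tendsto (fun n => (x n : H)) Filter.atTop (nhds u) →
    Filter.Tendsto (fun p : ℕ × ℕ => a.form (x p.1 - x p.2) (x p.1 - x p.2))
      Filter.atTop (nhds 0) →
    ∃ hu : u ∈ a.domain,
      Filter.Tendsto (fun n => a.form (x n - ⟨u, hu⟩) (x n - ⟨u, hu⟩)) Filter.atTop (nhds 0)

/-- The real part `a_R[u, v] = (a[u, v] + conj a[v, u]) / 2`. -/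
def realPart (a : SesqForm H) : SesqForm H where
  domain := a.domain
  form := LinearMap.mk₂'ₛₗ (RingHom.id ℂ) (starRingEnd ℂ)
    (fun u v => (1 / 2 : ℂ) * (a.form u v + starRingEnd ℂ (a.form v u)))
    (fun u u' v => by simp only [map_add, LinearMap.add_apply]; ring)
    (fun c u v => by
      simp only [map_smul, map_smulₛₗ, LinearMap.smul_apply, smul_eq_mul, map_mul,
        Complex.conj_conj, RingHom.id_apply]; ring)
    (fun u v v' => by simp only [map_add, LinearMap.add_apply]; ring)
    (fun c u v => by
      simp only [map_smul, map_smulₛₗ, LinearMap.smul_apply, smul_eq_mul, map_mul]; ring)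

/-- The graph of the operator associated with `a`: all pairs `(u, w)` with `u ∈ dom a` and
`a[u, v] = (w, v)` for all `v ∈ dom a`. -/
def operatorGraph (a : SesqForm H) : Submodule ℂ (H × H) where
  carrier := {p | ∃ u : a.domain, (u : H) = p.1 ∧ ∀ v : a.domain, a.form u v = inner ℂ (v : H) p.2}
  add_mem' := by
    rintro p q ⟨u, hu, h⟩ ⟨u', hu', h'⟩
    exact ⟨u + u', by simp [hu, hu'], fun v => by simp [h, h']⟩
  zero_mem' := ⟨0, by simp, fun v => by simp⟩
  smul_mem' := by
    rintro c p ⟨u, hu, h⟩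
    exact ⟨c • u, by simp [hu], fun v => by simp [h]⟩

/-- The operator associated with a densely defined form `a`. -/
def operator (a : SesqForm H) : H →ₗ.[ℂ] H := a.operatorGraph.toLinearPMap

/-- `a` is the form associated with the operator `A`, that is, the closed sectorial form that
has `dom A` as a core and satisfies `(A u, v) = a[u, v]` for `u ∈ dom A`, `v ∈ dom a`. By the
first representation theorem an `m`-sectorial operator has exactly one such form. -/
def IsAssociated (a : SesqForm H) (A : H →ₗ.[ℂ] H) : Prop :=
  a.IsSectorial ∧ a.IsClosed ∧
  (∀ u : A.domain, ∃ hu : (u : H) ∈ a.domain, ∀ v : a.domain,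
    a.form ⟨u, hu⟩ v = inner ℂ (v : H) (A u)) ∧
  ∀ u : a.domain, ∃ x : ℕ → a.domain, (∀ n, (x n : H) ∈ A.domain) ∧
    Filter.Tendsto (fun n => (x n : H)) Filter.atTop (nhds (u : H)) ∧
    Filter.Tendsto (fun n => a.form (x n - u) (x n - u)) Filter.atTop (nhds 0)

end SesqForm

open Classical in
/-- The closed sectorial form associated with an `m`-sectorial operator (with a default value
for other operators). -/
def formOf (A : H →ₗ.[ℂ] H) : SesqForm H :=
  if h : ∃ a : SesqForm H, a.IsAssociated A then h.choose else ⟨⊥, 0⟩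

/-- The real part `A_R` of an `m`-sectorial operator `A`: the operator associated with the real
part of the form of `A`. -/
def realPartOp (A : H →ₗ.[ℂ] H) : H →ₗ.[ℂ] H := (formOf A).realPart.operator

/-! ### The operators built from `B` -/

variable [CompleteSpace H]

/-- The real part `(T + T*) / 2` of a bounded operator. -/
def reOp (T : H →L[ℂ] H) : H →L[ℂ] H := (1 / 2 : ℂ) • (T + ContinuousLinearMap.adjoint T)

/-- The imaginary part `(T - T*) / (2 i)` of a bounded operator. -/
def imOp (T : H →L[ℂ] H) : H →L[ℂ] H :=
  (1 / (2 * Complex.I)) • (T - ContinuousLinearMap.adjoint T)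

/-- The bounded operator `B^(-1/2)`, for an `m`-accretive operator `B` with bounded inverse. -/
def invSqrt (B : H →ₗ.[ℂ] H) : H →L[ℂ] H := boundedInv (sqrtOp B)

/-- The operator `Z = i (Re B^(-1/2))⁻¹ Im B^(-1/2)`. -/
def opZ (B : H →ₗ.[ℂ] H) : H →ₗ.[ℂ] H :=
  Complex.I • opMul (ofBounded (reOp (invSqrt B))).inverse (ofBounded (imOp (invSqrt B)))

end KatoSquareRoot

end

open KatoSquareRoot

/-!
An operator with a bounded everywhere defined inverse is determined by that inverse, and its domain
is the range of the inverse. Put `S = B^(-1/2)`, so that `S² = B⁻¹` and `B^(*-1/2) = S*`: part (1)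
compares the ranges of `S`, `S*` and `Re S`. Accretivity of `S²` says that
`‖(Im S) f‖ ≤ ‖(Re S) f‖`, so by Douglas' lemma `Z` is a bounded contraction with
`S = (Re S)(1 + Z)` and `S* = (Re S)(1 - Z)`. Since `Re S` is injective, `ran (1 ± Z) = H` means
that `ran (Re S)` is contained in `ran S`, respectively in `ran S*`.

In part (2) put `P = (Re B⁻¹)^(1/2)`. Sectoriality gives `B⁻¹ = P Q P` with `Re Q ≥ 1`, the form of
`B` is `𝔟[P x, P y] = (Q⁻¹ x, y)` on `ran P`, and hence `B_R⁻¹ = P (Re Q⁻¹)⁻¹ P`, whose square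
root has range `ran P`. If `ran P ⊆ ran S`, say `P = S X`, then `S² = S X Q P` forces `S = X Q P`,
so that `ran S* ⊆ ran P`. The identity `Re (B⁻¹ f, f) = ‖P f‖² = ‖(Re S) f‖² - ‖(Im S) f‖²` turns
the suprema and `‖Z‖ < 1` into inequalities between `‖P f‖` and `‖(Re S) f‖`, that is, into the
inclusion of `ran (Re S)` in `ran P`.
-/

noncomputable section

namespace KatoSquareRoot

open Filter Topology
open scoped InnerProduct InnerProductSpace Ring

section Factorization

variable {𝕜 E F G : Type*} [RCLike 𝕜]

theorem exists_eq_comp_of_injective_of_range_le [NormedAddCommGroup E] [NormedSpace 𝕜 E]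
    [CompleteSpace E] [NormedAddCommGroup F] [NormedSpace 𝕜 F] [CompleteSpace F]
    [NormedAddCommGroup G] [NormedSpace 𝕜 G] {A : E →L[𝕜] G} {C : F →L[𝕜] G}
    (hC : Function.Injective C) (h : A.range ≤ C.range) : ∃ X : E →L[𝕜] F, A = C ∘L X := by
  choose X hX using fun x => h ⟨x, rfl⟩
  replace hX : ∀ x, C (X x) = A x := hX
  let X' : E →ₗ[𝕜] F :=
    { toFun := X
      map_add' := fun x y => hC (by simp only [map_add, hX])
      map_smul' := fun c x => hC (by simp only [map_smul, hX, RingHom.id_apply]) }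
  have hX' : ∀ x, C (X' x) = A x := hX
  have X'_continuous : Continuous X' := by
    refine X'.continuous_of_seq_closed_graph fun u x y hu hXu => hC ?_
    have hlim : Tendsto (fun n => A (u n)) atTop (𝓝 (C y)) := by
      simpa only [Function.comp_def, hX'] using (C.continuous.tendsto y).comp hXu
    exact (tendsto_nhds_unique hlim ((A.continuous.tendsto x).comp hu)).trans (hX' x).symm
  exact ⟨⟨X', X'_continuous⟩, ContinuousLinearMap.ext fun x => (hX' x).symm⟩

theorem exists_eq_comp_of_norm_le_of_denseRange [NormedAddCommGroup E] [NormedSpace 𝕜 E]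
    [NormedAddCommGroup F] [NormedSpace 𝕜 F] [NormedAddCommGroup G] [NormedSpace 𝕜 G]
    [CompleteSpace G] {A : E →L[𝕜] G} {C : E →L[𝕜] F} (hC : DenseRange C) {c : ℝ} (hc : 0 ≤ c)
    (h : ∀ x, ‖A x‖ ≤ c * ‖C x‖) : ∃ D : F →L[𝕜] G, A = D ∘L C ∧ ‖D‖ ≤ c :=
  ⟨A.toLinearMap.extendOfNorm C.toLinearMap,
    ContinuousLinearMap.ext fun x => (LinearMap.extendOfNorm_eq hC ⟨c, h⟩ x).symm,
    LinearMap.opNorm_extendOfNorm_le hC hc h⟩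

variable [NormedAddCommGroup E] [InnerProductSpace 𝕜 E]
  [NormedAddCommGroup F] [InnerProductSpace 𝕜 F]

theorem norm_le_of_norm_inner_le {T : E →L[𝕜] F} (hT : DenseRange T) {x : F} {c : ℝ}
    (hc : 0 ≤ c) (h : ∀ g, ‖⟪T g, x⟫_𝕜‖ ≤ c * ‖T g‖) : ‖x‖ ≤ c := by
  have h' : ∀ y, ‖⟪y, x⟫_𝕜‖ ≤ c * ‖y‖ := fun y =>
    hT.induction_on (p := fun y => ‖⟪y, x⟫_𝕜‖ ≤ c * ‖y‖) y
      (isClosed_le (by fun_prop) (by fun_prop)) h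
  have hx : ‖x‖ ^ 2 ≤ c * ‖x‖ := by simpa [inner_self_eq_norm_sq_to_K] using h' x
  by_contra! hcx
  nlinarith

variable [CompleteSpace F]

theorem exists_eq_comp_of_range_le [CompleteSpace E] [NormedAddCommGroup G] [NormedSpace 𝕜 G]
    {A : E →L[𝕜] G} {C : F →L[𝕜] G} (h : A.range ≤ C.range) :
    ∃ X : E →L[𝕜] F, A = C ∘L X := by
  have := C.isClosed_ker.completeSpace_coe
  let C' : (C.ker)ᗮ →L[𝕜] G := C ∘L (C.ker)ᗮ.subtypeL
  have hC' : Function.Injective C' := by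
    refine (injective_iff_map_eq_zero _).mpr fun x hx => Subtype.ext ?_
    exact (Submodule.mem_bot 𝕜).mp (C.ker.inf_orthogonal_eq_bot ▸ ⟨hx, x.2⟩)
  obtain ⟨X, hX⟩ := exists_eq_comp_of_injective_of_range_le (A := A) hC' <| h.trans <| by
    rintro _ ⟨y, rfl⟩
    obtain ⟨k, hk, z, hz, rfl⟩ := C.ker.exists_add_mem_mem_orthogonal y
    exact ⟨⟨z, hz⟩, by simp [C', show C k = 0 from hk]⟩
  exact ⟨(C.ker)ᗮ.subtypeL ∘L X, hX⟩

variable [NormedAddCommGroup G] [InnerProductSpace 𝕜 G] [CompleteSpace G]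

theorem exists_eq_comp_of_norm_le {A : E →L[𝕜] G} {C : E →L[𝕜] F} {c : ℝ}
    (h : ∀ x, ‖A x‖ ≤ c * ‖C x‖) : ∃ D : F →L[𝕜] G, A = D ∘L C := by
  let N := C.range.topologicalClosure
  have := C.range.isClosed_topologicalClosure.completeSpace_coe
  let C' : E →L[𝕜] N := C.codRestrict N fun x => C.range.le_topologicalClosure ⟨x, rfl⟩
  have hC' : DenseRange C' := by
    have hincl : DenseRange (Set.inclusion (subset_closure (s := (C.range : Set F)))) :=
      (denseRange_inclusion_iff _).mpr subset_rfl
    exact hincl.comp Set.rangeFactorization_surjective.denseRange (continuous_inclusion _)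
  obtain ⟨D, hD, -⟩ := exists_eq_comp_of_norm_le_of_denseRange (A := A) hC' (abs_nonneg c)
    fun x => (h x).trans (mul_le_mul_of_nonneg_right (le_abs_self c) (norm_nonneg _))
  refine ⟨D ∘L N.orthogonalProjectionOnto, hD.trans (ContinuousLinearMap.ext fun x => ?_)⟩
  exact congrArg D (Submodule.orthogonalProjectionOnto_mem_subspace_eq_self (C' x)).symm

variable [CompleteSpace E]

theorem range_le_range_iff_exists_norm_adjoint_le {A : E →L[𝕜] G} {C : F →L[𝕜] G} :
    A.range ≤ C.range ↔ ∃ c : ℝ, ∀ x, ‖(A†) x‖ ≤ c * ‖(C†) x‖ := by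
  constructor
  · intro h
    obtain ⟨X, rfl⟩ := exists_eq_comp_of_range_le h
    refine ⟨‖X†‖, fun x => ?_⟩
    rw [ContinuousLinearMap.adjoint_comp]
    exact (X†).le_opNorm _
  · rintro ⟨c, h⟩
    obtain ⟨D, hD⟩ := exists_eq_comp_of_norm_le h
    rw [← A.adjoint_adjoint, hD, ContinuousLinearMap.adjoint_comp, C.adjoint_adjoint]
    exact LinearMap.range_comp_le_range _ _

theorem denseRange_of_injective_adjoint {T : E →L[𝕜] F} (hT : Function.Injective (T†)) :
    DenseRange T := by
  have h : T.rangeᗮ = ⊥ := by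
    rw [ContinuousLinearMap.orthogonal_range]
    exact LinearMap.ker_eq_bot.mpr hT
  exact Submodule.dense_iff_topologicalClosure_eq_top.mpr
    (Submodule.topologicalClosure_eq_top_iff.mpr h)

theorem exists_eq_adjoint_comp_comp {K : E →L[𝕜] E} {P : E →L[𝕜] F} (hP : DenseRange P) {c : ℝ}
    (hc : 0 ≤ c) (h : ∀ f g, ‖⟪g, K f⟫_𝕜‖ ≤ c * ‖P f‖ * ‖P g‖) :
    ∃ Q : F →L[𝕜] F, K = P† ∘L Q ∘L P := by
  have hK : ∀ g, ‖(K†) g‖ ≤ c * ‖P‖ * ‖P g‖ := fun g => by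
    refine norm_le_of_norm_inner_le (T := .id 𝕜 E) denseRange_id (by positivity) fun f => ?_
    calc ‖⟪f, (K†) g⟫_𝕜‖ = ‖⟪g, K f⟫_𝕜‖ := by
          rw [ContinuousLinearMap.adjoint_inner_right, norm_inner_symm]
      _ ≤ c * ‖P f‖ * ‖P g‖ := h f g
      _ ≤ c * (‖P‖ * ‖f‖) * ‖P g‖ := by gcongr; exact P.le_opNorm f
      _ = c * ‖P‖ * ‖P g‖ * ‖f‖ := by ring
  obtain ⟨D, hD⟩ := exists_eq_comp_of_norm_le hK
  have hKD : K = P† ∘L D† := by rw [← ContinuousLinearMap.adjoint_comp, ← hD, K.adjoint_adjoint]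
  have hDP : ∀ f, ‖(D†) f‖ ≤ c * ‖P f‖ := fun f =>
    norm_le_of_norm_inner_le hP (by positivity) fun g => by
      simpa only [hKD, ContinuousLinearMap.comp_apply, ContinuousLinearMap.adjoint_inner_right]
        using h f g
  obtain ⟨Q, hQ⟩ := exists_eq_comp_of_norm_le hDP
  exact ⟨Q, by rw [hKD, hQ]⟩

theorem apply_eq_self_of_adjoint_apply_eq_self {T : E →L[𝕜] E} (hT : ‖T‖ ≤ 1) {x : E}
    (hx : (T†) x = x) : T x = x := by
  have hinner : RCLike.re ⟪T x, x⟫_𝕜 = ‖x‖ ^ 2 := by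
    rw [← ContinuousLinearMap.adjoint_inner_right, hx, inner_self_eq_norm_sq]
  have hnorm : ‖T x‖ ≤ ‖x‖ := by simpa using T.le_of_opNorm_le hT x
  have hsub : ‖T x - x‖ ^ 2 ≤ 0 := by
    rw [@norm_sub_sq 𝕜, hinner]
    nlinarith [norm_nonneg (T x)]
  exact sub_eq_zero.mp (norm_eq_zero.mp (pow_eq_zero_iff two_ne_zero |>.mp
    (le_antisymm hsub (sq_nonneg _))))

theorem isUnit_one_add_of_antilipschitzWith {T : E →L[𝕜] E} (hT : ‖T‖ ≤ 1) {c : NNReal}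
    (h : AntilipschitzWith c ⇑(1 + T)) : IsUnit (1 + T) := by
  refine ContinuousLinearMap.isUnit_iff_bijective.mpr
    ((1 + T).bijective_iff_dense_range_and_antilipschitz.mpr ⟨?_, c, h⟩)
  refine Submodule.dense_iff_topologicalClosure_eq_top.mp (denseRange_of_injective_adjoint ?_)
  refine (injective_iff_map_eq_zero _).mpr fun x hx => h.injective ?_
  have hx' : x + (T†) x = 0 := by
    simpa only [map_add, ← ContinuousLinearMap.star_eq_adjoint, star_add, star_one,
      add_apply, one_apply_eq_self] using hx
  have hfix := apply_eq_self_of_adjoint_apply_eq_self (T := -T) (x := x) (by rwa [norm_neg]) <| by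
    rw [map_neg, neg_apply, neg_eq_iff_add_eq_zero, add_comm, hx']
  rw [map_zero, add_apply, one_apply_eq_self, add_comm, ← neg_eq_iff_add_eq_zero, ← neg_apply,
    hfix]

end Factorization

section BoundedOperators

variable {E : Type*} [NormedAddCommGroup E] [InnerProductSpace ℂ E] {K Q : E →L[ℂ] E}

/-- `Q` is coercive: `Re (Q x, x) ≥ c ‖x‖²` for some `c > 0`. The bilinear notion `IsCoercive` of
the library does not cover sesquilinear forms. -/
def IsCoerciveOp (Q : E →L[ℂ] E) : Prop := ∃ c : ℝ, 0 < c ∧ ∀ x, c * ‖x‖ ^ 2 ≤ (⟪x, Q x⟫_ℂ).re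

/-- `Re (K f, f) ≥ 0` for all `f`: the notion `IsAccretive` for an everywhere defined bounded
operator. -/
def IsBoundedAccretive (K : E →L[ℂ] E) : Prop := ∀ f, 0 ≤ (⟪f, K f⟫_ℂ).re

theorem IsBoundedAccretive.isCoerciveOp_one_add (hK : IsBoundedAccretive K) :
    IsCoerciveOp (1 + K) := by
  refine ⟨1, one_pos, fun x => ?_⟩
  have hx : (⟪x, x⟫_ℂ).re = ‖x‖ ^ 2 := inner_self_eq_norm_sq (𝕜 := ℂ) x
  rw [add_apply, one_apply_eq_self, inner_add_right, Complex.add_re, hx]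
  linarith [hK x]

variable [CompleteSpace E]

theorem re_inner_adjoint_apply_self (K : E →L[ℂ] E) (x : E) :
    (⟪x, (K†) x⟫_ℂ).re = (⟪x, K x⟫_ℂ).re := by
  rw [ContinuousLinearMap.adjoint_inner_right]
  exact inner_re_symm (𝕜 := ℂ) _ _

theorem isSelfAdjoint_reOp (S : E →L[ℂ] E) : IsSelfAdjoint (reOp S) := by
  simp [IsSelfAdjoint, reOp, ContinuousLinearMap.star_eq_adjoint, add_comm]

theorem isSelfAdjoint_imOp (S : E →L[ℂ] E) : IsSelfAdjoint (imOp S) := by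
  simp [IsSelfAdjoint, imOp, ContinuousLinearMap.star_eq_adjoint, ← smul_neg]

theorem reOp_add_I_smul_imOp (S : E →L[ℂ] E) : reOp S + Complex.I • imOp S = S := by
  have hI : Complex.I * (1 / (2 * Complex.I)) = 1 / 2 := by field_simp
  rw [reOp, imOp, smul_smul, hI]
  module

theorem reOp_sub_I_smul_imOp (S : E →L[ℂ] E) : reOp S - Complex.I • imOp S = S† := by
  rw [eq_sub_iff_add_eq'.mpr (reOp_add_I_smul_imOp S), reOp]
  module

theorem re_inner_reOp (Q : E →L[ℂ] E) (x : E) : (⟪x, reOp Q x⟫_ℂ).re = (⟪x, Q x⟫_ℂ).re := by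
  rw [reOp, smul_apply, add_apply, inner_smul_right, inner_add_right,
    show (1 / 2 : ℂ) = ((1 / 2 : ℝ) : ℂ) by norm_num, Complex.re_ofReal_mul, Complex.add_re,
    re_inner_adjoint_apply_self]
  ring

theorem IsCoerciveOp.isUnit (hQ : IsCoerciveOp Q) : IsUnit Q := by
  obtain ⟨c, hc, h⟩ := hQ
  refine Q.isUnit_of_forall_le_norm_inner_map (c := ⟨c, hc.le⟩) hc fun x => ?_
  rw [norm_inner_symm, mul_comm]
  exact (h x).trans (Complex.re_le_norm _)

theorem IsCoerciveOp.ringInverse (hQ : IsCoerciveOp Q) : IsCoerciveOp Q⁻¹ʳ := by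
  have hu := hQ.isUnit
  obtain ⟨c, hc, h⟩ := hQ
  refine ⟨c / (‖Q‖ + 1) ^ 2, by positivity, fun x => ?_⟩
  obtain ⟨y, rfl⟩ := (ContinuousLinearMap.isUnit_iff_bijective.mp hu).surjective x
  have hy : Q⁻¹ʳ (Q y) = y := by
    rw [← mul_apply_eq_comp, Ring.inverse_mul_cancel _ hu, one_apply_eq_self]
  have hQy : ‖Q y‖ ≤ (‖Q‖ + 1) * ‖y‖ := Q.le_of_opNorm_le (by linarith) y
  calc c / (‖Q‖ + 1) ^ 2 * ‖Q y‖ ^ 2 ≤ c / (‖Q‖ + 1) ^ 2 * ((‖Q‖ + 1) * ‖y‖) ^ 2 := by gcongr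
    _ = c * ‖y‖ ^ 2 := by field_simp
    _ ≤ (⟪y, Q y⟫_ℂ).re := h y
    _ = (⟪Q y, Q⁻¹ʳ (Q y)⟫_ℂ).re := by rw [hy]; exact inner_re_symm (𝕜 := ℂ) _ _

theorem IsCoerciveOp.reOp (hQ : IsCoerciveOp Q) : IsCoerciveOp (reOp Q) := by
  simpa only [IsCoerciveOp, re_inner_reOp] using hQ

theorem IsBoundedAccretive.adjoint (hK : IsBoundedAccretive K) : IsBoundedAccretive (K†) :=
  fun f => (hK f).trans_eq (re_inner_adjoint_apply_self K f).symm

end BoundedOperators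

section BinomialSeries

theorem succ_mul_choose_half (n : ℕ) :
    ((n : ℝ) + 1) * Ring.choose (1 / 2 : ℝ) (n + 1) = Ring.choose (1 / 2 : ℝ) n * (1 / 2 - n) := by
  simpa [nsmul_eq_mul, Nat.choose_succ_self_right, Ring.choose_one_right]
    using Ring.choose_smul_choose (1 / 2 : ℝ) (Nat.le_succ n)

theorem sum_abs_choose_half (n : ℕ) :
    ∑ i ∈ Finset.range (n + 2), |Ring.choose (1 / 2 : ℝ) i| +
      (2 * n + 1) * |Ring.choose (1 / 2 : ℝ) (n + 1)| = 2 := by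
  induction n with
  | zero => norm_num [Finset.sum_range_succ, abs_of_pos]
  | succ n ih =>
    have h := congrArg abs (succ_mul_choose_half (n + 1))
    rw [abs_mul, abs_mul, abs_of_pos (by positivity : (0 : ℝ) < ((n + 1 : ℕ) : ℝ) + 1),
      abs_of_nonpos (by push_cast; linarith [(n.cast_nonneg : (0 : ℝ) ≤ n)] :
        (1 / 2 - ((n + 1 : ℕ) : ℝ)) ≤ 0)] at h
    rw [Finset.sum_range_succ]
    push_cast at h ⊢
    linarith

theorem summable_abs_choose_half : Summable fun n => |Ring.choose (1 / 2 : ℝ) n| := by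
  refine summable_of_sum_range_le (c := 2) (fun _ => abs_nonneg _) fun n => ?_
  calc ∑ i ∈ Finset.range n, |Ring.choose (1 / 2 : ℝ) i|
      ≤ ∑ i ∈ Finset.range (n + 2), |Ring.choose (1 / 2 : ℝ) i| :=
        Finset.sum_le_sum_of_subset_of_nonneg (Finset.range_mono (by omega))
          fun _ _ _ => abs_nonneg _
    _ ≤ _ := le_add_of_nonneg_right (by positivity)
    _ = 2 := sum_abs_choose_half n

variable {H : Type*} [NormedAddCommGroup H] [InnerProductSpace ℂ H] {T : H →L[ℂ] H}

theorem summable_norm_choose_half_smul_pow (hT : ‖T‖ ≤ 1) :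
    Summable fun n : ℕ => ‖Ring.choose (1 / 2 : ℝ) n • T ^ n‖ := by
  refine summable_abs_choose_half.of_nonneg_of_le (fun _ => norm_nonneg _) fun n => ?_
  have hTn : ‖T ^ n‖ ≤ 1 := by
    induction n with
    | zero => exact ContinuousLinearMap.norm_id_le
    | succ n ih => exact pow_succ T n ▸ norm_mul_le_of_le ih hT |>.trans_eq (one_mul 1)
  rw [norm_smul, Real.norm_eq_abs]
  exact mul_le_of_le_one_right (abs_nonneg _) hTn

variable [CompleteSpace H]

theorem sqrtOneAdd_mul_self (hT : ‖T‖ ≤ 1) : sqrtOneAdd T * sqrtOneAdd T = 1 + T := by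
  have hsum := summable_norm_choose_half_smul_pow hT
  have hconv : ∀ n : ℕ, ∑ kl ∈ Finset.HasAntidiagonal.antidiagonal n,
      Ring.choose (1 / 2 : ℝ) kl.1 • T ^ kl.1 * Ring.choose (1 / 2 : ℝ) kl.2 • T ^ kl.2 =
        (Nat.choose 1 n : ℝ) • T ^ n := fun n => by
    rw [← Ring.choose_natCast, Nat.cast_one, show (1 : ℝ) = 1 / 2 + 1 / 2 by norm_num,
      Ring.add_choose_eq n (Commute.all _ _), Finset.sum_smul]
    refine Finset.sum_congr rfl fun kl hkl => ?_
    rw [smul_mul_smul_comm, ← pow_add, Finset.HasAntidiagonal.mem_antidiagonal.mp hkl]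
    norm_num
  rw [sqrtOneAdd, tsum_mul_tsum_eq_tsum_sum_antidiagonal_of_summable_norm hsum hsum,
    tsum_congr hconv, tsum_eq_sum (s := Finset.range 2)]
  · simp [Finset.sum_range_succ]
  · intro n hn
    rw [Nat.choose_eq_zero_of_lt (by simpa using hn), Nat.cast_zero, zero_smul]

theorem commute_sqrtOneAdd_right {A : H →L[ℂ] H} (h : Commute A T) (hT : ‖T‖ ≤ 1) :
    Commute A (sqrtOneAdd T) := by
  have hsum := (summable_norm_choose_half_smul_pow hT).of_norm
  rw [Commute, SemiconjBy, sqrtOneAdd, ← hsum.tsum_mul_left, ← hsum.tsum_mul_right]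
  exact tsum_congr fun n => (h.pow_right n).smul_right _

theorem adjoint_sqrtOneAdd (T : H →L[ℂ] H) : (sqrtOneAdd T)† = sqrtOneAdd (T†) := by
  simp only [sqrtOneAdd, ← ContinuousLinearMap.star_eq_adjoint, tsum_star, star_smul, star_pow,
    star_trivial]

end BinomialSeries

section AccretiveSqrt

variable {H : Type*} [NormedAddCommGroup H] [InnerProductSpace ℂ H] {K : H →L[ℂ] H}

/-- The Cayley transform `(I - A)(I + A)⁻¹ = I - 2 (I + K)⁻¹` of the possibly unbounded operator
`A = K⁻¹`, in terms of the bounded operator `K`. -/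
def invCayley (K : H →L[ℂ] H) : H →L[ℂ] H := 1 - (2 : ℂ) • (1 + K)⁻¹ʳ

/-- The square root of a bounded accretive operator `K`, chosen so that it is inverse to
`sqrtOp A` if `K` is inverse to `A`. -/
def accretiveSqrt (K : H →L[ℂ] H) : H →L[ℂ] H :=
  sqrtOneAdd (invCayley K) * (sqrtOneAdd (-invCayley K))⁻¹ʳ

theorem commute_ringInverse_right {M : Type*} [MonoidWithZero M] {a b : M} (h : Commute a b) :
    Commute a b⁻¹ʳ := by
  by_cases hb : IsUnit b
  · obtain ⟨u, rfl⟩ := hb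
    rw [Ring.inverse_unit]
    exact h.units_inv_right
  · rw [Ring.inverse_non_unit _ hb]
    exact Commute.zero_right a

variable [CompleteSpace H]

theorem adjoint_invCayley (K : H →L[ℂ] H) : (invCayley K)† = invCayley (K†) := by
  simp only [invCayley, ← ContinuousLinearMap.star_eq_adjoint, star_sub, star_one, star_smul,
    ← Ring.inverse_star, star_add]
  simp

namespace IsBoundedAccretive

theorem one_add_invCayley (hK : IsBoundedAccretive K) :
    1 + invCayley K = K * (1 - invCayley K) := by
  have h := Ring.mul_inverse_cancel _ hK.isCoerciveOp_one_add.isUnit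
  rw [add_mul, one_mul, ← eq_sub_iff_add_eq'] at h
  rw [invCayley, sub_sub_cancel, mul_smul_comm, h]
  module

theorem norm_invCayley_le (hK : IsBoundedAccretive K) : ‖invCayley K‖ ≤ 1 := by
  refine ContinuousLinearMap.opNorm_le_bound _ zero_le_one fun x => ?_
  obtain ⟨g, rfl⟩ :=
    (ContinuousLinearMap.isUnit_iff_bijective.mp hK.isCoerciveOp_one_add.isUnit).surjective x
  have hg : invCayley K ((1 + K) g) = K g - g := by
    rw [← mul_apply_eq_comp, invCayley, sub_mul, smul_mul_assoc,
      Ring.inverse_mul_cancel _ hK.isCoerciveOp_one_add.isUnit]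
    simp only [sub_apply, smul_apply, one_mul, add_apply, one_apply_eq_self]
    module
  rw [hg, one_mul, add_apply, one_apply_eq_self, add_comm]
  refine le_of_sq_le_sq ?_ (norm_nonneg _)
  have h : 0 ≤ (⟪K g, g⟫_ℂ).re := (hK g).trans_eq (inner_re_symm (𝕜 := ℂ) _ _)
  rw [@norm_sub_sq ℂ, @norm_add_sq ℂ, RCLike.re_to_complex]
  linarith

theorem isUnit_sqrtOneAdd_neg_invCayley (hK : IsBoundedAccretive K) :
    IsUnit (sqrtOneAdd (-invCayley K)) := by
  refine (isUnit_pow_iff two_ne_zero).mp ?_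
  rw [pow_two, sqrtOneAdd_mul_self (by rw [norm_neg]; exact hK.norm_invCayley_le), invCayley,
    neg_sub, add_sub_cancel]
  exact hK.isCoerciveOp_one_add.isUnit.ringInverse.smul (Units.mk0 (2 : ℂ) two_ne_zero)

theorem commute_sqrtOneAdd (hK : IsBoundedAccretive K) :
    Commute (sqrtOneAdd (invCayley K)) (sqrtOneAdd (-invCayley K))⁻¹ʳ := by
  have hT := hK.norm_invCayley_le
  refine commute_ringInverse_right
    (commute_sqrtOneAdd_right (Commute.neg_right ?_) (by rwa [norm_neg]))
  exact (commute_sqrtOneAdd_right (Commute.refl _) hT).symm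

theorem sqrtOneAdd_invCayley_mul_self (hK : IsBoundedAccretive K) :
    sqrtOneAdd (invCayley K) * sqrtOneAdd (invCayley K) =
      K * (sqrtOneAdd (-invCayley K) * sqrtOneAdd (-invCayley K)) := by
  have hT := hK.norm_invCayley_le
  rw [sqrtOneAdd_mul_self hT, sqrtOneAdd_mul_self (by rwa [norm_neg]), ← sub_eq_add_neg,
    hK.one_add_invCayley]

theorem accretiveSqrt_mul_self (hK : IsBoundedAccretive K) :
    accretiveSqrt K * accretiveSqrt K = K := by
  have hX2 := hK.sqrtOneAdd_invCayley_mul_self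
  have hcomm := hK.commute_sqrtOneAdd
  have hY := Ring.mul_inverse_cancel _ hK.isUnit_sqrtOneAdd_neg_invCayley
  rw [accretiveSqrt]
  set X := sqrtOneAdd (invCayley K)
  set Y := sqrtOneAdd (-invCayley K)
  calc X * Y⁻¹ʳ * (X * Y⁻¹ʳ) = X * (Y⁻¹ʳ * X) * Y⁻¹ʳ := by noncomm_ring
    _ = X * X * Y⁻¹ʳ * Y⁻¹ʳ := by rw [← hcomm.eq]; noncomm_ring
    _ = K * (Y * (Y * Y⁻¹ʳ) * Y⁻¹ʳ) := by rw [hX2]; noncomm_ring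
    _ = K := by rw [hY, mul_one, hY, mul_one]

theorem adjoint_accretiveSqrt (hK : IsBoundedAccretive K) :
    (accretiveSqrt K)† = accretiveSqrt (K†) := by
  rw [accretiveSqrt, accretiveSqrt, hK.adjoint.commute_sqrtOneAdd.eq, ← adjoint_invCayley,
    ← map_neg, ← adjoint_sqrtOneAdd, ← adjoint_sqrtOneAdd, ← ContinuousLinearMap.star_eq_adjoint,
    ← ContinuousLinearMap.star_eq_adjoint, ← ContinuousLinearMap.star_eq_adjoint, star_mul,
    Ring.inverse_star]

end IsBoundedAccretive

end AccretiveSqrt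

section Graphs

variable {H : Type*} [NormedAddCommGroup H] [InnerProductSpace ℂ H]
  {A B : H →ₗ.[ℂ] H} {K S T : H →L[ℂ] H}

theorem mem_graph_ofBounded {x y : H} : (x, y) ∈ (ofBounded T).graph ↔ T x = y := by
  rw [LinearPMap.mem_graph_iff]
  exact ⟨fun ⟨z, hz, hy⟩ => by subst hz; exact hy, fun h => ⟨⟨x, trivial⟩, rfl, h⟩⟩

theorem mem_graph_opMul {x z : H} :
    (x, z) ∈ (opMul A B).graph ↔ ∃ y, (x, y) ∈ B.graph ∧ (y, z) ∈ A.graph := by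
  rw [LinearPMap.mem_graph_iff]
  constructor
  · rintro ⟨⟨_, u, hu, rfl⟩, rfl, rfl⟩
    exact ⟨B u, B.mem_graph u, A.mem_graph ⟨B u, hu⟩⟩
  · rintro ⟨y, hxy, hyz⟩
    obtain ⟨u, rfl, rfl⟩ := (LinearPMap.mem_graph_iff _).mp hxy
    obtain ⟨v, hv, rfl⟩ := (LinearPMap.mem_graph_iff _).mp hyz
    have hBu : B u ∈ A.domain := (show (v : H) = B u from hv) ▸ v.2
    exact ⟨⟨u, u, hBu, rfl⟩, rfl, congrArg A (Subtype.ext hv.symm)⟩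

theorem mem_graph_add {x z : H} :
    (x, z) ∈ (A + B).graph ↔ ∃ y y', (x, y) ∈ A.graph ∧ (x, y') ∈ B.graph ∧ y + y' = z := by
  simp only [LinearPMap.mem_graph_iff]
  constructor
  · rintro ⟨u, rfl, rfl⟩
    exact ⟨_, _, ⟨⟨u, u.2.1⟩, rfl, rfl⟩, ⟨⟨u, u.2.2⟩, rfl, rfl⟩, rfl⟩
  · rintro ⟨_, _, ⟨u, rfl, rfl⟩, ⟨v, hv, rfl⟩, rfl⟩
    exact ⟨⟨u, u.2, hv ▸ v.2⟩, rfl, congrArg (A u + B ·) (Subtype.ext hv.symm)⟩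

theorem ofBounded_add (S T : H →L[ℂ] H) : ofBounded S + ofBounded T = ofBounded (S + T) := by
  refine LinearPMap.eq_of_eq_graph (Submodule.ext fun ⟨x, z⟩ => ?_)
  simp only [mem_graph_add, mem_graph_ofBounded, exists_and_left, exists_eq_left', add_apply]

theorem ofBounded_sub (S T : H →L[ℂ] H) : ofBounded S - ofBounded T = ofBounded (S - T) := by
  rw [sub_eq_add_neg, sub_eq_add_neg, ← ofBounded_add]
  rfl

theorem ofBounded_mul (S T : H →L[ℂ] H) :
    opMul (ofBounded S) (ofBounded T) = ofBounded (S * T) := by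
  refine LinearPMap.eq_of_eq_graph (Submodule.ext fun ⟨x, z⟩ => ?_)
  simp only [mem_graph_opMul, mem_graph_ofBounded, exists_eq_left', mul_apply_eq_comp]

theorem ran_ofBounded (T : H →L[ℂ] H) : ran (ofBounded T) = T.range := by
  ext y
  exact ⟨fun ⟨x, hx⟩ => ⟨x, hx⟩, fun ⟨x, hx⟩ => ⟨⟨x, trivial⟩, hx⟩⟩

theorem opNorm_ofBounded (T : H →L[ℂ] H) : opNorm (ofBounded T) = ‖T‖ₑ := by
  refine le_antisymm (iSup₂_le fun x hx => ?_) (le_of_forall_lt_imp_le_of_dense fun c hc => ?_)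
  · refine (T.le_opENorm x).trans (mul_le_of_le_one_right' ?_)
    rw [← ofReal_norm]
    exact ENNReal.ofReal_le_one.mpr hx
  · lift c to NNReal using hc.ne_top
    obtain ⟨x, hx, hcx⟩ := T.exists_lt_apply_of_lt_opNNNorm (ENNReal.coe_lt_coe.mp hc)
    exact (ENNReal.coe_lt_coe.mpr hcx).le.trans
      (le_iSup₂_of_le (⟨x, trivial⟩ : (ofBounded T).domain) (NNReal.coe_le_coe.mpr hx.le) le_rfl)

theorem norm_apply_le_of_isBoundedOp (hA : IsBoundedOp A) (u : A.domain) :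
    ‖A u‖ ≤ (opNorm A).toReal * ‖u‖ := by
  rcases eq_or_ne u 0 with rfl | hu
  · simp
  set v : A.domain := ((‖u‖⁻¹ : ℝ) : ℂ) • u
  have hv : ‖v‖ ≤ 1 := by
    rw [norm_smul, Complex.norm_real, norm_inv, norm_norm,
      inv_mul_cancel₀ (norm_ne_zero_iff.mpr hu)]
  have hAv : ‖A v‖ₑ ≤ opNorm A :=
    le_iSup₂_of_le (f := fun (x : A.domain) (_ : ‖x‖ ≤ 1) => ‖A x‖ₑ) v hv le_rfl
  have := ENNReal.toReal_mono hA.ne hAv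
  rwa [toReal_enorm, LinearPMap.map_smul, norm_smul, Complex.norm_real, norm_inv, norm_norm,
    inv_mul_le_iff₀' (norm_pos_iff.mpr hu)] at this

theorem mem_graph_inverse_ofBounded (hT : Function.Injective T) {x y : H} :
    (x, y) ∈ (ofBounded T).inverse.graph ↔ T y = x := by
  have hker : LinearMap.ker (ofBounded T).toFun = ⊥ :=
    LinearMap.ker_eq_bot.mpr fun u v huv => Subtype.ext (hT huv)
  rw [LinearPMap.inverse_graph hker, ← mem_graph_ofBounded]
  simp

theorem inverse_ofBounded_domain (T : H →L[ℂ] H) : (ofBounded T).inverse.domain = T.range := by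
  rw [LinearPMap.inverse_domain, ← ran_ofBounded]
  rfl

theorem isBoundedInverse_iff_forall_mem_graph :
    IsBoundedInverse A K ↔ ∀ x y, (x, y) ∈ A.graph ↔ K y = x := by
  refine ⟨fun h x y => ⟨fun hxy => ?_, fun hxy => hxy ▸ h.1 y⟩, fun h =>
    ⟨fun y => (h _ _).mpr rfl, fun x => (h _ _).mp (A.mem_graph x)⟩⟩
  obtain ⟨u, rfl, rfl⟩ := (LinearPMap.mem_graph_iff _).mp hxy
  exact h.2 u

namespace IsBoundedInverse

theorem mem_graph_iff (h : IsBoundedInverse A K) {x y : H} : (x, y) ∈ A.graph ↔ K y = x :=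
  isBoundedInverse_iff_forall_mem_graph.mp h x y

theorem domain_eq (h : IsBoundedInverse A K) : A.domain = K.range := by
  ext x
  exact LinearPMap.mem_domain_iff.trans (exists_congr fun y => h.mem_graph_iff)

theorem injective (h : IsBoundedInverse A K) : Function.Injective K :=
  (injective_iff_map_eq_zero K).mpr fun _ hx =>
    LinearPMap.graph_fst_eq_zero_snd _ (h.mem_graph_iff.mpr hx) rfl

theorem boundedInv_eq (h : IsBoundedInverse A K) : boundedInv A = K := by
  have hA : HasBoundedInverse A := ⟨K, h⟩
  rw [boundedInv, dif_pos hA]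
  ext y
  exact (h.mem_graph_iff.mp (hA.choose_spec.1 y)).symm

theorem isBoundedAccretive (h : IsBoundedInverse A K) (hA : IsAccretive A) :
    IsBoundedAccretive K := fun f => by
  obtain ⟨u, hu, hf⟩ := (LinearPMap.mem_graph_iff _).mp (h.1 f)
  have := hA u
  rw [show (u : H) = K f from hu, show A u = f from hf] at this
  exact this.trans_eq (inner_re_symm (𝕜 := ℂ) _ _)

theorem isBoundedOp_iff_exists_antilipschitzWith (h : IsBoundedInverse A K) :
    IsBoundedOp A ↔ ∃ c, AntilipschitzWith c K := by
  constructor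
  · intro hA
    refine ⟨(opNorm A).toNNReal, K.antilipschitz_of_bound fun y => ?_⟩
    obtain ⟨u, hu, rfl⟩ := (LinearPMap.mem_graph_iff _).mp (h.1 y)
    rw [← show (u : H) = K (A u) from hu]
    exact norm_apply_le_of_isBoundedOp hA u
  · rintro ⟨c, hc⟩
    refine lt_of_le_of_lt (iSup₂_le fun x hx => ?_) (ENNReal.coe_lt_top (r := c))
    rw [enorm_le_coe]
    refine (hc.le_mul_nnnorm (map_zero K) (A x)).trans ?_
    rw [h.2 x]
    exact mul_le_of_le_one_right' hx

theorem opMul_ofBounded_iff (h : IsBoundedInverse A S) (hT : Function.Injective T) :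
    IsBoundedInverse (opMul A (ofBounded T)) K ↔ S = T * K := by
  simp only [isBoundedInverse_iff_forall_mem_graph, mem_graph_opMul, mem_graph_ofBounded,
    exists_eq_left', h.mem_graph_iff]
  constructor
  · exact fun hK => ContinuousLinearMap.ext fun y => (hK _ y).mpr rfl
  · rintro rfl x y
    exact hT.eq_iff

theorem isBoundedOp_and_hasBoundedInverse_opMul_iff (h : IsBoundedInverse A S)
    (hT : Function.Injective T) :
    IsBoundedOp (opMul A (ofBounded T)) ∧ HasBoundedInverse (opMul A (ofBounded T)) ↔
      ∃ K, S = T * K ∧ ∃ c, AntilipschitzWith c K := by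
  rw [HasBoundedInverse, ← exists_and_left]
  refine exists_congr fun K => ?_
  rw [← h.opMul_ofBounded_iff hT, and_comm]
  exact and_congr_right fun hK => hK.isBoundedOp_iff_exists_antilipschitzWith

variable [CompleteSpace H]

theorem idOp_add (h : IsBoundedInverse A K) (hK : IsBoundedAccretive K) :
    IsBoundedInverse (idOp + A) (1 - (1 + K)⁻¹ʳ) := by
  have hu := hK.isCoerciveOp_one_add.isUnit
  have hbij := ContinuousLinearMap.isUnit_iff_bijective.mp hu
  refine isBoundedInverse_iff_forall_mem_graph.mpr fun x y => ?_
  obtain ⟨g, rfl⟩ := hbij.surjective y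
  set y := (1 + K) g
  have hg : (1 + K)⁻¹ʳ y = g := by
    rw [← mul_apply_eq_comp, Ring.inverse_mul_cancel _ hu, one_apply_eq_self]
  calc (x, y) ∈ (idOp + A).graph ↔ K (y - x) = x := by
        simp only [mem_graph_add, idOp, mem_graph_ofBounded, ContinuousLinearMap.id_apply,
          h.mem_graph_iff]
        exact ⟨fun ⟨_, _, hx, hKx, hy⟩ => by rwa [← hy, ← hx, add_sub_cancel_left],
          fun hx => ⟨_, _, rfl, hx, add_sub_cancel _ _⟩⟩
    _ ↔ (1 + K) (y - x) = y := by
        rw [add_apply, one_apply_eq_self, sub_add, sub_eq_self, sub_eq_zero, eq_comm]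
    _ ↔ y - x = g := hbij.injective.eq_iff
    _ ↔ (1 - (1 + K)⁻¹ʳ) y = x := by
        rw [sub_apply, one_apply_eq_self, hg, sub_eq_iff_eq_add, sub_eq_iff_eq_add']

theorem cayley_eq (h : IsBoundedInverse A K) (hK : IsBoundedAccretive K) :
    cayley A = invCayley K := by
  rw [cayley, (h.idOp_add hK).boundedInv_eq, invCayley, ← ContinuousLinearMap.one_def]
  module

protected theorem sqrtOp (h : IsBoundedInverse A K) (hK : IsBoundedAccretive K) :
    IsBoundedInverse (sqrtOp A) (accretiveSqrt K) := by
  rw [KatoSquareRoot.sqrtOp, h.cayley_eq hK, accretiveSqrt]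
  have hX2 := hK.sqrtOneAdd_invCayley_mul_self
  have hY := hK.isUnit_sqrtOneAdd_neg_invCayley
  set X := sqrtOneAdd (invCayley K)
  set Y := sqrtOneAdd (-invCayley K)
  have hYb := ContinuousLinearMap.isUnit_iff_bijective.mp hY
  have hX : Function.Injective X := by
    refine Function.Injective.of_comp (f := X) ?_
    change Function.Injective (X * X)
    rw [hX2]
    exact h.injective.comp (hYb.injective.comp hYb.injective)
  refine isBoundedInverse_iff_forall_mem_graph.mpr fun x y => ?_
  obtain ⟨z, rfl⟩ := hYb.surjective y
  simp only [mem_graph_opMul, mem_graph_inverse_ofBounded hX, mem_graph_ofBounded,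
    ← mul_apply_eq_comp, mul_assoc, Ring.inverse_mul_cancel _ hY, mul_one]
  exact ⟨fun ⟨w, hw, hwz⟩ => hYb.injective hwz ▸ hw, fun hz => ⟨z, hz, rfl⟩⟩

protected theorem adjoint (h : IsBoundedInverse A K) (hA : Dense (A.domain : Set H)) :
    IsBoundedInverse A.adjoint (K†) := by
  constructor
  · intro y
    have hy : ∀ x : A.domain, ⟪y, (x : H)⟫_ℂ = ⟪(K†) y, A x⟫_ℂ := fun x => by
      rw [ContinuousLinearMap.adjoint_inner_left, h.2 x]
    have hd : (K†) y ∈ A.adjoint.domain := LinearPMap.mem_adjoint_domain_of_exists _ ⟨y, hy⟩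
    exact (LinearPMap.mem_graph_iff _).mpr
      ⟨⟨_, hd⟩, rfl, LinearPMap.adjoint_apply_eq hA ⟨_, hd⟩ hy⟩
  · intro x
    refine ext_inner_right ℂ fun f => ?_
    obtain ⟨u, hu, rfl⟩ := (LinearPMap.mem_graph_iff _).mp (h.1 f)
    rw [ContinuousLinearMap.adjoint_inner_left, ← show (u : H) = K (A u) from hu]
    exact LinearPMap.adjoint_isFormalAdjoint hA x u

end IsBoundedInverse

end Graphs

section RealAndImaginaryParts

variable {H : Type*} [NormedAddCommGroup H] [InnerProductSpace ℂ H] {S T X Y Z : H →L[ℂ] H}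

theorem range_le_range_mul_iff (hS : Function.Injective S) :
    S.range ≤ (S * X).range ↔ X.range = ⊤ := by
  rw [LinearMap.range_eq_top]
  constructor
  · exact fun h g => (h ⟨g, rfl⟩).imp fun _ hf => hS hf
  · rintro h _ ⟨g, rfl⟩
    exact (h g).imp fun _ hf => congrArg S hf

theorem range_mul_eq_top_iff (h : Commute X Y) :
    (X * Y).range = ⊤ ↔ X.range = ⊤ ∧ Y.range = ⊤ := by
  simp only [LinearMap.range_eq_top]
  refine ⟨fun hXY => ⟨Function.Surjective.of_comp (g := Y) hXY, ?_⟩, fun ⟨hX, hY⟩ => hX.comp hY⟩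
  rw [h.eq] at hXY
  exact Function.Surjective.of_comp (g := X) hXY

theorem antilipschitzWith_of_mul_eq_one (h : Y * X = 1) : AntilipschitzWith ‖Y‖₊ X :=
  Y.lipschitz.to_rightInverse fun f => DFunLike.congr_fun h f

variable [CompleteSpace H]

theorem reOp_adjoint (S : H →L[ℂ] H) : reOp (S†) = reOp S := by
  rw [reOp, reOp, ContinuousLinearMap.adjoint_adjoint, add_comm]

theorem imOp_adjoint (S : H →L[ℂ] H) : imOp (S†) = -imOp S := by
  rw [imOp, imOp, ContinuousLinearMap.adjoint_adjoint, ← smul_neg, neg_sub]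

theorem apply_eq_reOp_add (S : H →L[ℂ] H) (f : H) :
    S f = reOp S f + Complex.I • imOp S f :=
  (DFunLike.congr_fun (reOp_add_I_smul_imOp S) f).symm

theorem adjoint_apply_eq_reOp_sub (S : H →L[ℂ] H) (f : H) :
    (S†) f = reOp S f - Complex.I • imOp S f :=
  (DFunLike.congr_fun (reOp_sub_I_smul_imOp S) f).symm

theorem re_inner_mul_self (S : H →L[ℂ] H) (f : H) :
    (⟪f, (S * S) f⟫_ℂ).re = ‖reOp S f‖ ^ 2 - ‖imOp S f‖ ^ 2 := by
  have h : (⟪reOp S f, imOp S f⟫_ℂ).im = -(⟪imOp S f, reOp S f⟫_ℂ).im :=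
    inner_im_symm (𝕜 := ℂ) _ _
  rw [mul_apply_eq_comp, ← ContinuousLinearMap.adjoint_inner_left, adjoint_apply_eq_reOp_sub S,
    apply_eq_reOp_add S, inner_sub_left, inner_add_right, inner_add_right, inner_smul_left,
    inner_smul_right, inner_smul_left, inner_smul_right, inner_self_eq_norm_sq_to_K,
    inner_self_eq_norm_sq_to_K]
  simp only [Complex.coe_algebraMap, ← Complex.ofReal_pow, Complex.conj_I, neg_mul, Complex.sub_re,
    Complex.add_re, Complex.ofReal_re, Complex.mul_re, Complex.I_re, zero_mul, Complex.I_im, h,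
    mul_neg, one_mul, sub_neg_eq_add, zero_add, Complex.neg_re, zero_sub, neg_neg,
    Complex.ofReal_im, mul_zero, sub_self, Complex.mul_im]
  ring

theorem norm_adjoint_sq_add_norm_sq (S : H →L[ℂ] H) (f : H) :
    ‖(S†) f‖ ^ 2 + ‖S f‖ ^ 2 = 2 * (‖reOp S f‖ ^ 2 + ‖imOp S f‖ ^ 2) := by
  have h := parallelogram_law_with_norm ℂ (reOp S f) (Complex.I • imOp S f)
  rw [norm_smul, Complex.norm_I, one_mul] at h
  rw [apply_eq_reOp_add S, adjoint_apply_eq_reOp_sub S]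
  linarith

theorem range_reOp_le_sup (S : H →L[ℂ] H) : (reOp S).range ≤ S.range ⊔ (S†).range := by
  rintro _ ⟨f, rfl⟩
  exact Submodule.smul_mem _ _ (add_mem (Submodule.mem_sup_left ⟨f, rfl⟩)
    (Submodule.mem_sup_right ⟨f, rfl⟩))

theorem range_eq_range_adjoint_of_range_reOp_le
    (h : (reOp S).range ≤ S.range ⊓ (S†).range) : S.range = (S†).range := by
  have hadd : ∀ f, S f + (S†) f = (2 : ℂ) • reOp S f := fun f => by
    rw [apply_eq_reOp_add S, adjoint_apply_eq_reOp_sub S]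
    module
  refine le_antisymm ?_ ?_
  · rintro _ ⟨f, rfl⟩
    change S f ∈ _
    rw [eq_sub_of_add_eq (hadd f)]
    exact sub_mem (Submodule.smul_mem _ _ (h ⟨f, rfl⟩).2) ⟨f, rfl⟩
  · rintro _ ⟨f, rfl⟩
    change (S†) f ∈ _
    rw [eq_sub_of_add_eq' (hadd f)]
    exact sub_mem (Submodule.smul_mem _ _ (h ⟨f, rfl⟩).1) ⟨f, rfl⟩

/-- `Z` is a contraction representing `i (Re S)⁻¹ Im S`. -/
structure IsReImQuotient (S Z : H →L[ℂ] H) : Prop where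
  injective_reOp : Function.Injective (reOp S)
  reOp_mul : reOp S * Z = Complex.I • imOp S
  norm_le : ‖Z‖ ≤ 1

theorem exists_isReImQuotient (hS : Function.Injective S) (hacc : IsBoundedAccretive (S * S)) :
    ∃ Z, IsReImQuotient S Z := by
  have hle : ∀ f, ‖imOp S f‖ ≤ 1 * ‖reOp S f‖ := fun f => by
    rw [one_mul]
    refine le_of_sq_le_sq ?_ (norm_nonneg _)
    have := hacc f
    rw [re_inner_mul_self] at this
    linarith
  have hinj : Function.Injective (reOp S) := (injective_iff_map_eq_zero _).mpr fun f hf => by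
    have him : imOp S f = 0 := by simpa [hf] using hle f
    refine hS ?_
    rw [apply_eq_reOp_add, hf, him, smul_zero, add_zero, map_zero]
  have hdense : DenseRange (reOp S) :=
    denseRange_of_injective_adjoint (by rwa [(isSelfAdjoint_reOp S).adjoint_eq])
  obtain ⟨W, hW, hW1⟩ := exists_eq_comp_of_norm_le_of_denseRange hdense zero_le_one hle
  refine ⟨Complex.I • W†, hinj, ?_, ?_⟩
  · have := congrArg ContinuousLinearMap.adjoint hW
    rw [ContinuousLinearMap.adjoint_comp, (isSelfAdjoint_reOp S).adjoint_eq,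
      (isSelfAdjoint_imOp S).adjoint_eq] at this
    rw [mul_smul_comm, this]
    rfl
  · rwa [norm_smul, Complex.norm_I, one_mul, LinearIsometryEquiv.norm_map]

namespace IsReImQuotient

protected theorem adjoint (h : IsReImQuotient S Z) : IsReImQuotient (S†) (-Z) where
  injective_reOp := by rw [reOp_adjoint]; exact h.injective_reOp
  reOp_mul := by rw [reOp_adjoint, imOp_adjoint, mul_neg, h.reOp_mul, smul_neg]
  norm_le := (norm_neg Z).trans_le h.norm_le

theorem reOp_mul_one_add (h : IsReImQuotient S Z) : reOp S * (1 + Z) = S := by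
  rw [mul_add, mul_one, h.reOp_mul, reOp_add_I_smul_imOp]

theorem reOp_mul_one_sub (h : IsReImQuotient S Z) : reOp S * (1 - Z) = S† := by
  rw [mul_sub, mul_one, h.reOp_mul, reOp_sub_I_smul_imOp]

theorem range_one_add_eq_top_iff (h : IsReImQuotient S Z) :
    (1 + Z).range = ⊤ ↔ (reOp S).range ≤ S.range := by
  have := range_le_range_mul_iff (X := 1 + Z) h.injective_reOp
  rwa [h.reOp_mul_one_add, Iff.comm] at this

theorem range_one_sub_eq_top_iff (h : IsReImQuotient S Z) :
    (1 - Z).range = ⊤ ↔ (reOp S).range ≤ (S†).range := by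
  have := h.adjoint.range_one_add_eq_top_iff
  rwa [reOp_adjoint, ← sub_eq_add_neg] at this

/-- The relation `1 + Z = (1 - Z) T` makes `(T + 1) / 2` a right inverse of `1 - Z`. -/
theorem isUnit_of_eq_adjoint_mul (h : IsReImQuotient S Z) (hS : Function.Injective (S†))
    (hT : S = S† * T) {c} (hc : AntilipschitzWith c T) : IsUnit (1 + Z) ∧ IsUnit (1 - Z) := by
  have hZT : 1 + Z = (1 - Z) * T := by
    ext f
    refine h.injective_reOp ?_
    simp only [← mul_apply_eq_comp, ← mul_assoc]
    rw [h.reOp_mul_one_add, h.reOp_mul_one_sub, ← hT]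
  have hsurj : ∀ y, (1 - Z) ((1 / 2 : ℂ) • (T + 1) y) = y := fun y => by
    rw [map_smul, ← mul_apply_eq_comp, mul_add, ← hZT, mul_one, add_add_sub_cancel, add_apply,
      one_apply_eq_self]
    module
  have hinj : Function.Injective ⇑(1 - Z) := by
    refine Function.Injective.of_comp (f := reOp S) ?_
    rwa [← h.reOp_mul_one_sub] at hS
  have hsub : IsUnit (1 - Z) :=
    ContinuousLinearMap.isUnit_iff_bijective.mpr ⟨hinj, fun y => ⟨_, hsurj y⟩⟩
  obtain ⟨d, hd⟩ : ∃ d, AntilipschitzWith d ⇑(1 - Z) :=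
    ⟨_, antilipschitzWith_of_mul_eq_one (Ring.inverse_mul_cancel _ hsub)⟩
  have hadd : AntilipschitzWith (c * d) ⇑(1 + Z) := by
    rw [hZT]
    exact hd.comp hc
  exact ⟨isUnit_one_add_of_antilipschitzWith h.norm_le hadd, hsub⟩

end IsReImQuotient

theorem exists_eq_mul_of_range_eq (hS : Function.Injective S) (hT : Function.Injective T)
    (h : S.range = T.range) : ∃ X, S = T * X ∧ ∃ c, AntilipschitzWith c X := by
  obtain ⟨X, hX⟩ := exists_eq_comp_of_injective_of_range_le hT h.le
  obtain ⟨Y, hY⟩ := exists_eq_comp_of_injective_of_range_le hS h.ge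
  have hYX : Y * X = 1 := by
    ext f
    exact hS (DFunLike.congr_fun (hX.trans (congrArg (· ∘L X) hY)) f).symm
  exact ⟨X, hX, _, antilipschitzWith_of_mul_eq_one hYX⟩

theorem tfae_range_eq_range_adjoint (h : IsReImQuotient S Z) (hS : Function.Injective S)
    (hS' : Function.Injective (S†)) :
    List.TFAE [
      S.range = (S†).range,
      ∃ T, S = S† * T ∧ ∃ c, AntilipschitzWith c T,
      (1 + Z).range = ⊤ ∧ (1 - Z).range = ⊤,
      (1 - Z * Z).range = ⊤,
      (reOp S).range ≤ S.range ⊓ (S†).range] := by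
  tfae_have 1 → 2 := exists_eq_mul_of_range_eq hS hS'
  tfae_have 2 → 3 := fun ⟨T, hT, c, hc⟩ => by
    simp only [LinearMap.range_eq_top]
    exact (h.isUnit_of_eq_adjoint_mul hS' hT hc).imp
      (fun hadd => (ContinuousLinearMap.isUnit_iff_bijective.mp hadd).surjective)
      fun hsub => (ContinuousLinearMap.isUnit_iff_bijective.mp hsub).surjective
  tfae_have 3 ↔ 4 := by
    have hcomm : Commute (1 + Z) (1 - Z) :=
      ((Commute.one_left _).add_left (Commute.one_right Z |>.sub_right (Commute.refl Z)))
    rw [← range_mul_eq_top_iff hcomm, show (1 + Z) * (1 - Z) = 1 - Z * Z by noncomm_ring]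
  tfae_have 3 ↔ 5 := by
    rw [h.range_one_add_eq_top_iff, h.range_one_sub_eq_top_iff, le_inf_iff]
  tfae_have 5 → 1 := range_eq_range_adjoint_of_range_reOp_le
  tfae_finish

theorem opZ_eq_ofBounded {B : H →ₗ.[ℂ] H} (h : IsReImQuotient (invSqrt B) Z) :
    opZ B = ofBounded Z := by
  have him : imOp (invSqrt B) = reOp (invSqrt B) * (-Complex.I • Z) := by
    rw [mul_smul_comm, h.reOp_mul, smul_smul, neg_mul, Complex.I_mul_I, neg_neg, one_smul]
  have hZ : opMul (ofBounded (reOp (invSqrt B))).inverse (ofBounded (imOp (invSqrt B))) =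
      ofBounded (-Complex.I • Z) := by
    refine LinearPMap.eq_of_eq_graph (Submodule.ext fun ⟨x, z⟩ => ?_)
    simp only [mem_graph_opMul, mem_graph_ofBounded, exists_eq_left',
      mem_graph_inverse_ofBounded h.injective_reOp, him, mul_apply_eq_comp]
    rw [h.injective_reOp.eq_iff, eq_comm]
  calc opZ B = ofBounded (Complex.I • -Complex.I • Z) := by rw [opZ, hZ]; rfl
    _ = ofBounded Z := by rw [smul_smul, mul_neg, Complex.I_mul_I, neg_neg, one_smul]

end RealAndImaginaryParts

section SectorialForms

variable {E : Type*} [AddCommGroup E] [Module ℂ E] {t : E →ₗ[ℂ] E →ₗ⋆[ℂ] ℂ} {k : ℝ}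

/-- `t` is sectorial with vertex `0`, where `k` is the tangent of the semi-angle. The form lives on
an arbitrary space `E`, in order to cover both the forms `SesqForm` and `(K f, g)` for a bounded
operator `K`. -/
def IsSectorialForm (t : E →ₗ[ℂ] E →ₗ⋆[ℂ] ℂ) (k : ℝ) : Prop :=
  ∀ u, 0 ≤ (t u u).re ∧ |(t u u).im| ≤ k * (t u u).re

theorem form_polarization (t : E →ₗ[ℂ] E →ₗ⋆[ℂ] ℂ) (u v : E) :
    4 * t u v = t (u + v) (u + v) - t (u - v) (u - v) +
      Complex.I * t (u + Complex.I • v) (u + Complex.I • v) -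
      Complex.I * t (u - Complex.I • v) (u - Complex.I • v) := by
  simp only [map_add, map_sub, LinearMap.add_apply, LinearMap.sub_apply, map_smul, map_smulₛₗ,
    LinearMap.smul_apply, smul_eq_mul, Complex.conj_I]
  linear_combination (2 * t u v - 2 * t v u) * Complex.I_mul_I

theorem form_smul_smul (t : E →ₗ[ℂ] E →ₗ⋆[ℂ] ℂ) (c : ℂ) (u : E) :
    t (c • u) (c • u) = (‖c‖ ^ 2 : ℝ) * t u u := by
  simp only [map_smul, map_smulₛₗ, LinearMap.smul_apply, smul_eq_mul]
  rw [← mul_assoc, Complex.conj_mul', Complex.ofReal_pow]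

theorem re_form_parallelogram (t : E →ₗ[ℂ] E →ₗ⋆[ℂ] ℂ) (u v : E) :
    (t (u + v) (u + v)).re + (t (u - v) (u - v)).re = 2 * ((t u u).re + (t v v).re) := by
  simp only [map_add, map_sub, LinearMap.add_apply, LinearMap.sub_apply, Complex.add_re,
    Complex.sub_re]
  ring

namespace IsSectorialForm

theorem norm_self_le (ht : IsSectorialForm t k) (u : E) : ‖t u u‖ ≤ (1 + k) * (t u u).re := by
  refine (Complex.norm_le_abs_re_add_abs_im _).trans ?_
  rw [abs_of_nonneg (ht u).1]
  linarith [(ht u).2]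

theorem norm_le_add (ht : IsSectorialForm t k) (u v : E) :
    ‖t u v‖ ≤ (1 + k) * ((t u u).re + (t v v).re) := by
  have hI : t (Complex.I • v) (Complex.I • v) = t v v := by
    rw [form_smul_smul, Complex.norm_I]; simp
  have hpar := congrArg ((1 + k) * ·) (re_form_parallelogram t u v)
  have hparI := congrArg ((1 + k) * ·) (re_form_parallelogram t u (Complex.I • v))
  simp only [hI] at hpar hparI
  have hnorm : 4 * ‖t u v‖ ≤ ‖t (u + v) (u + v)‖ + ‖t (u - v) (u - v)‖ +
      ‖t (u + Complex.I • v) (u + Complex.I • v)‖ +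
      ‖t (u - Complex.I • v) (u - Complex.I • v)‖ := by
    have h4 : 4 * ‖t u v‖ = ‖4 * t u v‖ := by simp
    rw [h4, form_polarization]
    refine (norm_sub_le _ _).trans (add_le_add ((norm_add_le _ _).trans
      (add_le_add (norm_sub_le _ _) ?_)) ?_) <;> simp
  linarith [ht.norm_self_le (u + v), ht.norm_self_le (u - v),
    ht.norm_self_le (u + Complex.I • v), ht.norm_self_le (u - Complex.I • v)]

/-- From `norm_le_add` by scaling `u`. -/
theorem norm_sq_le (ht : IsSectorialForm t k) (u v : E) :
    ‖t u v‖ ^ 2 ≤ (2 * (1 + k)) ^ 2 * ((t u u).re * (t v v).re) := by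
  have hquad : ∀ x : ℝ, 0 ≤ ((1 + k) * (t u u).re) * (x * x) + (-‖t u v‖) * x +
      (1 + k) * (t v v).re := fun x => by
    have h := ht.norm_le_add ((x : ℂ) • u) v
    rw [form_smul_smul, Complex.re_ofReal_mul, map_smul, LinearMap.smul_apply, norm_smul,
      Complex.norm_real, Real.norm_eq_abs, sq_abs] at h
    have hx : x * ‖t u v‖ ≤ |x| * ‖t u v‖ := by gcongr; exact le_abs_self x
    linarith
  have hdiscrim := discrim_le_zero hquad
  rw [discrim] at hdiscrim
  linarith

theorem norm_le (ht : IsSectorialForm t k) (u v : E) :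
    ‖t u v‖ ≤ 2 * |1 + k| * (√(t u u).re * √(t v v).re) := by
  refine le_of_sq_le_sq ((ht.norm_sq_le u v).trans_eq ?_) (by positivity)
  simp only [mul_pow, sq_abs, Real.sq_sqrt (ht u).1, Real.sq_sqrt (ht v).1]

section Limits

variable {ι : Type*} {l : Filter ι} {x : ι → E} {u : E}

theorem tendsto_self_zero_iff (ht : IsSectorialForm t k) :
    Tendsto (fun i => t (x i) (x i)) l (𝓝 0) ↔ Tendsto (fun i => (t (x i) (x i)).re) l (𝓝 0) := by
  refine ⟨fun h => (Complex.continuous_re.tendsto 0).comp h, fun h => ?_⟩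
  refine squeeze_zero_norm (fun i => ht.norm_self_le (x i)) ?_
  simpa using h.const_mul (1 + k)

theorem tendsto_left (ht : IsSectorialForm t k)
    (h : Tendsto (fun i => t (x i - u) (x i - u)) l (𝓝 0)) (v : E) :
    Tendsto (fun i => t (x i) v) l (𝓝 (t u v)) := by
  rw [← tendsto_sub_nhds_zero_iff]
  have hbound := (((ht.tendsto_self_zero_iff.mp h).sqrt).mul_const √(t v v).re).const_mul
    (2 * |1 + k|)
  rw [Real.sqrt_zero, zero_mul, mul_zero] at hbound
  refine squeeze_zero_norm (fun i => ?_) hbound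
  rw [← LinearMap.sub_apply, ← map_sub]
  exact ht.norm_le _ _

theorem tendsto_sub_sub (ht : IsSectorialForm t k)
    (h : Tendsto (fun i => t (x i - u) (x i - u)) l (𝓝 0)) :
    Tendsto (fun p : ι × ι => t (x p.1 - x p.2) (x p.1 - x p.2)) (l ×ˢ l) (𝓝 0) := by
  rw [ht.tendsto_self_zero_iff] at h ⊢
  have hsum := ((h.comp tendsto_fst).add (h.comp tendsto_snd)).const_mul 2
  rw [add_zero, mul_zero] at hsum
  refine squeeze_zero (fun p => (ht _).1) (fun p => ?_) hsum
  have hpar := re_form_parallelogram t (x p.1 - u) (x p.2 - u)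
  rw [sub_sub_sub_cancel_right] at hpar
  exact (le_add_of_nonneg_left (ht _).1).trans_eq hpar

end Limits

end IsSectorialForm

end SectorialForms

section AssociatedForms

variable {H : Type*} [NormedAddCommGroup H] [InnerProductSpace ℂ H] {A : H →ₗ.[ℂ] H}
  {a b : SesqForm H}

theorem SesqForm.IsSectorial.exists_isSectorialForm (ha : a.IsSectorial) :
    ∃ k, IsSectorialForm a.form k := by
  obtain ⟨α, -, -, h⟩ := ha
  exact ⟨_, h⟩

namespace SesqForm.IsAssociated

theorem domain_le (ha : a.IsAssociated A) : A.domain ≤ a.domain :=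
  fun x hx => (ha.2.2.1 ⟨x, hx⟩).1

theorem form_inclusion (ha : a.IsAssociated A) (x : A.domain) (v : a.domain) :
    a.form (Submodule.inclusion ha.domain_le x) v = ⟪(v : H), A x⟫_ℂ :=
  (ha.2.2.1 x).2 v

theorem exists_tendsto (ha : a.IsAssociated A) (u : a.domain) :
    ∃ x : ℕ → A.domain, Tendsto (fun n => (x n : H)) atTop (𝓝 u) ∧
      Tendsto (fun n => a.form (Submodule.inclusion ha.domain_le (x n) - u)
        (Submodule.inclusion ha.domain_le (x n) - u)) atTop (𝓝 0) := by
  obtain ⟨x, hx, hxu, hform⟩ := ha.2.2.2 u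
  exact ⟨fun n => ⟨x n, hx n⟩, hxu, hform⟩

theorem exists_form_eq (ha : a.IsAssociated A) (hb : b.IsAssociated A) (u : a.domain) :
    ∃ hu : (u : H) ∈ b.domain, ∀ (v : a.domain) (hv : (v : H) ∈ b.domain),
      a.form u v = b.form ⟨u, hu⟩ ⟨v, hv⟩ := by
  obtain ⟨k, hka⟩ := ha.1.exists_isSectorialForm
  obtain ⟨l, hlb⟩ := hb.1.exists_isSectorialForm
  obtain ⟨x, hxu, hxa⟩ := ha.exists_tendsto u
  have hcauchy := hka.tendsto_sub_sub hxa
  rw [prod_atTop_atTop_eq] at hcauchy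
  obtain ⟨hu, hxb⟩ := hb.2.1 (fun n => Submodule.inclusion hb.domain_le (x n)) u hxu <| by
    refine hcauchy.congr fun p => ?_
    rw [← map_sub, ← map_sub, ha.form_inclusion, hb.form_inclusion]
    rfl
  refine ⟨hu, fun v hv => tendsto_nhds_unique (hka.tendsto_left hxa v) ?_⟩
  refine (hlb.tendsto_left hxb ⟨v, hv⟩).congr fun n => ?_
  rw [ha.form_inclusion, hb.form_inclusion]

theorem unique (ha : a.IsAssociated A) (hb : b.IsAssociated A) : a = b := by
  have hdom : a.domain = b.domain :=
    le_antisymm (fun u hu => (ha.exists_form_eq hb ⟨u, hu⟩).1)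
      fun u hu => (hb.exists_form_eq ha ⟨u, hu⟩).1
  have hform := fun u => (ha.exists_form_eq hb u).2
  obtain ⟨D, s⟩ := a
  obtain ⟨D', t⟩ := b
  obtain rfl : D = D' := hdom
  congr
  ext u v
  exact hform u v v.2

theorem realPartOp_eq (ha : a.IsAssociated A) : realPartOp A = a.realPart.operator := by
  have hA : ∃ a : SesqForm H, a.IsAssociated A := ⟨a, ha⟩
  rw [realPartOp, formOf, dif_pos hA, hA.choose_spec.unique ha]

end SesqForm.IsAssociated

end AssociatedForms

section RangeForms

variable {E H : Type*} [NormedAddCommGroup E] [InnerProductSpace ℂ E] [NormedAddCommGroup H]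
  [InnerProductSpace ℂ H] {P : E →L[ℂ] H} {hP : Function.Injective P} {D : E →L[ℂ] E}
  {A : H →ₗ.[ℂ] H}

/-- The form `a[P x, P y] = (D x, y)` with domain `ran P`, for an injective operator `P`. It is the
form of the operator with inverse `P D⁻¹ P*`. -/
def rangeForm (P : E →L[ℂ] H) (hP : Function.Injective P) (D : E →L[ℂ] E) : SesqForm H where
  domain := P.range
  form := LinearMap.mk₂'ₛₗ (RingHom.id ℂ) (starRingEnd ℂ)
    (fun u v => ⟪(LinearEquiv.ofInjective P.toLinearMap hP).symm v,
      D ((LinearEquiv.ofInjective P.toLinearMap hP).symm u)⟫_ℂ)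
    (fun u u' v => by simp only [map_add, inner_add_right])
    (fun c u v => by simp only [map_smul, inner_smul_right, RingHom.id_apply, smul_eq_mul])
    (fun u v v' => by simp only [map_add, inner_add_left])
    (fun c u v => by simp only [map_smul, inner_smul_left, smul_eq_mul])

/-- `P` as a linear equivalence of its domain with the domain of `rangeForm P hP D`. -/
def equivRangeForm (P : E →L[ℂ] H) (hP : Function.Injective P) (D : E →L[ℂ] E) :
    E ≃ₗ[ℂ] (rangeForm P hP D).domain :=
  LinearEquiv.ofInjective P.toLinearMap hP

theorem coe_equivRangeForm (x : E) : (equivRangeForm P hP D x : H) = P x := rfl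

theorem rangeForm_equivRangeForm (x y : E) :
    (rangeForm P hP D).form (equivRangeForm P hP D x) (equivRangeForm P hP D y) = ⟪y, D x⟫_ℂ := by
  change ⟪(LinearEquiv.ofInjective P.toLinearMap hP).symm (LinearEquiv.ofInjective _ hP y),
    D ((LinearEquiv.ofInjective P.toLinearMap hP).symm (LinearEquiv.ofInjective _ hP x))⟫_ℂ = _
  rw [LinearEquiv.symm_apply_apply, LinearEquiv.symm_apply_apply]

theorem tendsto_rangeForm_sub {x : ℕ → E} {y : E} (hx : Tendsto x atTop (𝓝 y)) :
    Tendsto (fun n => (rangeForm P hP D).form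
      (equivRangeForm P hP D (x n) - equivRangeForm P hP D y)
      (equivRangeForm P hP D (x n) - equivRangeForm P hP D y)) atTop (𝓝 0) := by
  simp only [← map_sub, rangeForm_equivRangeForm]
  have hcont : Continuous fun z => ⟪z - y, D (z - y)⟫_ℂ := by fun_prop
  have hlim := hcont.tendsto y
  rw [sub_self, inner_zero_left] at hlim
  exact hlim.comp hx

theorem IsCoerciveOp.cauchySeq (hD : IsCoerciveOp D) {x : ℕ → E}
    (hx : Tendsto (fun p : ℕ × ℕ => ⟪x p.1 - x p.2, D (x p.1 - x p.2)⟫_ℂ) atTop (𝓝 0)) :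
    CauchySeq x := by
  obtain ⟨c, hc, h⟩ := hD
  rw [cauchySeq_iff_tendsto_dist_atTop_0]
  have hre := (((Complex.continuous_re.tendsto 0).comp hx).const_mul c⁻¹).sqrt
  rw [Complex.zero_re, mul_zero, Real.sqrt_zero] at hre
  refine squeeze_zero (fun _ => dist_nonneg) (fun p => ?_) hre
  rw [dist_eq_norm]
  exact Real.le_sqrt_of_sq_le ((le_inv_mul_iff₀ hc).mpr (h _))

theorem IsCoerciveOp.isSectorial_rangeForm (hD : IsCoerciveOp D) :
    (rangeForm P hP D).IsSectorial := by
  obtain ⟨c, hc, h⟩ := hD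
  refine ⟨Real.arctan (‖D‖ / c), Real.arctan_nonneg.mpr (by positivity),
    Real.arctan_lt_pi_div_two _, fun u => ?_⟩
  obtain ⟨x, rfl⟩ := (equivRangeForm P hP D).surjective u
  rw [rangeForm_equivRangeForm, Real.tan_arctan]
  refine ⟨(by positivity : 0 ≤ c * ‖x‖ ^ 2).trans (h x), ?_⟩
  calc |(⟪x, D x⟫_ℂ).im| ≤ ‖x‖ * ‖D x‖ :=
        (Complex.abs_im_le_norm _).trans (norm_inner_le_norm _ _)
    _ ≤ ‖x‖ * (‖D‖ * ‖x‖) := by gcongr; exact D.le_opNorm x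
    _ = ‖D‖ / c * (c * ‖x‖ ^ 2) := by field_simp
    _ ≤ ‖D‖ / c * (⟪x, D x⟫_ℂ).re := by gcongr; exact h x

variable [CompleteSpace E]

theorem IsCoerciveOp.isClosed_rangeForm (hD : IsCoerciveOp D) : (rangeForm P hP D).IsClosed := by
  intro u v hu hform
  obtain ⟨x, rfl⟩ : ∃ x : ℕ → E, u = fun n => equivRangeForm P hP D (x n) :=
    ⟨fun n => (equivRangeForm P hP D).symm (u n), by simp⟩
  simp only [← map_sub, rangeForm_equivRangeForm] at hform
  obtain ⟨y, hy⟩ := cauchySeq_tendsto_of_complete (hD.cauchySeq hform)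
  obtain rfl : v = P y := tendsto_nhds_unique hu ((P.continuous.tendsto y).comp hy)
  exact ⟨(equivRangeForm P hP D y).2, tendsto_rangeForm_sub hy⟩

theorem realPart_rangeForm : (rangeForm P hP D).realPart = rangeForm P hP (reOp D) := by
  suffices h : (rangeForm P hP D).realPart.form = (rangeForm P hP (reOp D)).form from
    congrArg (SesqForm.mk P.range) h
  ext u v
  obtain ⟨x, rfl⟩ := (equivRangeForm P hP D).surjective u
  obtain ⟨y, rfl⟩ := (equivRangeForm P hP D).surjective v
  calc (1 / 2 : ℂ) * ((rangeForm P hP D).form (equivRangeForm P hP D x) (equivRangeForm P hP D y) +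
        starRingEnd ℂ
          ((rangeForm P hP D).form (equivRangeForm P hP D y) (equivRangeForm P hP D x)))
      = ⟪y, reOp D x⟫_ℂ := by
        rw [rangeForm_equivRangeForm, rangeForm_equivRangeForm, inner_conj_symm, reOp, smul_apply,
          add_apply, inner_smul_right, inner_add_right, ContinuousLinearMap.adjoint_inner_right]
    _ = _ := (rangeForm_equivRangeForm x y).symm

variable [CompleteSpace H]

theorem inner_apply_adjoint_eq_iff (hD : IsUnit D) (x : E) (w : H) :
    (∀ y, ⟪y, D x⟫_ℂ = ⟪P y, w⟫_ℂ) ↔ D⁻¹ʳ ((P†) w) = x := by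
  simp only [← ContinuousLinearMap.adjoint_inner_right]
  constructor
  · intro h
    rw [← ext_inner_left ℂ h, ← mul_apply_eq_comp, Ring.inverse_mul_cancel _ hD, one_apply_eq_self]
  · rintro rfl y
    rw [← mul_apply_eq_comp D, Ring.mul_inverse_cancel _ hD, one_apply_eq_self]

theorem IsCoerciveOp.rangeForm_isAssociated (hD : IsCoerciveOp D)
    (hA : IsBoundedInverse A (P ∘L D⁻¹ʳ ∘L P†)) : (rangeForm P hP D).IsAssociated A := by
  refine ⟨hD.isSectorial_rangeForm, hD.isClosed_rangeForm, fun u => ?_, fun u => ?_⟩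
  · have hu : (equivRangeForm P hP D (D⁻¹ʳ ((P†) (A u))) : H) = u := hA.2 u
    refine ⟨hu ▸ (equivRangeForm P hP D _).2, fun v => ?_⟩
    obtain ⟨y, rfl⟩ := (equivRangeForm P hP D).surjective v
    refine Eq.trans ?_ ((inner_apply_adjoint_eq_iff hD.isUnit _ _).mpr rfl y)
    rw [← rangeForm_equivRangeForm (hP := hP)]
    congr 2
    exact Subtype.ext hu.symm
  · have hdense : DenseRange (D⁻¹ʳ ∘L P†) :=
      (ContinuousLinearMap.isUnit_iff_bijective.mp hD.isUnit.ringInverse).surjective.denseRange.comp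
        (denseRange_of_injective_adjoint (by rwa [ContinuousLinearMap.adjoint_adjoint]))
        D⁻¹ʳ.continuous
    obtain ⟨x, rfl⟩ := (equivRangeForm P hP D).surjective u
    obtain ⟨w, hw, hlim⟩ := mem_closure_iff_seq_limit.mp (hdense x)
    refine ⟨fun n => equivRangeForm P hP D (w n), fun n => ?_,
      (P.continuous.tendsto x).comp hlim, tendsto_rangeForm_sub hlim⟩
    obtain ⟨f, hf⟩ := hw n
    rw [hA.domain_eq, coe_equivRangeForm, ← hf]
    exact ⟨f, rfl⟩

theorem mem_operatorGraph_rangeForm (hD : IsUnit D) {u w : H} :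
    (u, w) ∈ (rangeForm P hP D).operatorGraph ↔ (P ∘L D⁻¹ʳ ∘L P†) w = u := by
  constructor
  · rintro ⟨v, rfl, h⟩
    obtain ⟨x, rfl⟩ := (equivRangeForm P hP D).surjective v
    refine congrArg P ((inner_apply_adjoint_eq_iff hD x w).mp fun y => ?_)
    exact (rangeForm_equivRangeForm x y).symm.trans (h (equivRangeForm P hP D y))
  · rintro rfl
    refine ⟨equivRangeForm P hP D (D⁻¹ʳ ((P†) w)), rfl, fun v => ?_⟩
    obtain ⟨y, rfl⟩ := (equivRangeForm P hP D).surjective v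
    rw [rangeForm_equivRangeForm]
    exact (inner_apply_adjoint_eq_iff hD _ _).mpr rfl y

theorem isBoundedInverse_operator_rangeForm (hD : IsUnit D) (hP' : Function.Injective (P†)) :
    IsBoundedInverse (rangeForm P hP D).operator (P ∘L D⁻¹ʳ ∘L P†) := by
  have hinj : Function.Injective (P ∘L D⁻¹ʳ ∘L P†) :=
    hP.comp ((ContinuousLinearMap.isUnit_iff_bijective.mp hD.ringInverse).injective.comp hP')
  refine isBoundedInverse_iff_forall_mem_graph.mpr fun u w => ?_
  rw [SesqForm.operator, Submodule.toLinearPMap_graph_eq, mem_operatorGraph_rangeForm hD]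
  rintro ⟨u, w⟩ hw rfl
  exact hinj ((mem_operatorGraph_rangeForm hD).mp hw |>.trans (map_zero _).symm)

theorem isBoundedInverse_realPartOp (hP : Function.Injective P) (hP' : Function.Injective (P†))
    (hD : IsCoerciveOp D) (hA : IsBoundedInverse A (P ∘L D⁻¹ʳ ∘L P†)) :
    IsBoundedInverse (realPartOp A) (P ∘L (reOp D)⁻¹ʳ ∘L P†) := by
  rw [(hD.rangeForm_isAssociated (hP := hP) hA).realPartOp_eq, realPart_rangeForm]
  exact isBoundedInverse_operator_rangeForm hD.reOp.isUnit hP'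

end RangeForms

section RangeOfSquareRoots

variable {E F H : Type*} [NormedAddCommGroup E] [InnerProductSpace ℂ E] [CompleteSpace E]
  [NormedAddCommGroup F] [InnerProductSpace ℂ F] [CompleteSpace F]
  [NormedAddCommGroup H] [InnerProductSpace ℂ H] [CompleteSpace H]
  {P : E →L[ℂ] H} {Q : E →L[ℂ] E}

theorem range_eq_range_of_comp_adjoint_eq {V : F →L[ℂ] H} (hQ : IsCoerciveOp Q)
    (h : V ∘L V† = P ∘L Q ∘L P†) : V.range = P.range := by
  obtain ⟨c, hc, hle⟩ := hQ
  have hV : ∀ f, ‖(V†) f‖ ^ 2 = (⟪(P†) f, Q ((P†) f)⟫_ℂ).re := fun f => by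
    rw [ContinuousLinearMap.adjoint_inner_left, ← inner_self_eq_norm_sq (𝕜 := ℂ),
      ContinuousLinearMap.adjoint_inner_left]
    exact congrArg (fun T : H →L[ℂ] H => (⟪f, T f⟫_ℂ).re) h
  refine le_antisymm (range_le_range_iff_exists_norm_adjoint_le.mpr ⟨√‖Q‖, fun f => ?_⟩)
    (range_le_range_iff_exists_norm_adjoint_le.mpr ⟨√c⁻¹, fun f => ?_⟩)
  · refine le_of_sq_le_sq ?_ (by positivity)
    rw [hV, mul_pow, Real.sq_sqrt (norm_nonneg _)]
    calc (⟪(P†) f, Q ((P†) f)⟫_ℂ).re ≤ ‖(P†) f‖ * ‖Q ((P†) f)‖ :=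
          (Complex.re_le_norm _).trans (norm_inner_le_norm _ _)
      _ ≤ ‖(P†) f‖ * (‖Q‖ * ‖(P†) f‖) := by gcongr; exact Q.le_opNorm _
      _ = _ := by ring
  · refine le_of_sq_le_sq ?_ (by positivity)
    rw [mul_pow, Real.sq_sqrt (by positivity), le_inv_mul_iff₀ hc, hV]
    exact hle _

theorem sqrtOp_realPartOp_domain {B : H →ₗ.[ℂ] H} (hP : Function.Injective P)
    (hP' : Function.Injective (P†)) (hQ : IsCoerciveOp Q)
    (hB : IsBoundedInverse B (P ∘L Q ∘L P†)) : (sqrtOp (realPartOp B)).domain = P.range := by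
  rw [← Ring.inverse_inverse hQ.isUnit] at hB
  have hL := isBoundedInverse_realPartOp hP hP' hQ.ringInverse hB
  have hcoercive := hQ.ringInverse.reOp.ringInverse
  have hself : IsSelfAdjoint (reOp Q⁻¹ʳ)⁻¹ʳ := (isSelfAdjoint_reOp _).ringInverse
  set L := P ∘L (reOp Q⁻¹ʳ)⁻¹ʳ ∘L P† with hLdef
  have hLself : L† = L := by
    rw [hLdef, ContinuousLinearMap.adjoint_comp, ContinuousLinearMap.adjoint_comp,
      ContinuousLinearMap.adjoint_adjoint, ← ContinuousLinearMap.star_eq_adjoint, hself.star_eq,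
      ContinuousLinearMap.comp_assoc]
  have hLacc : IsBoundedAccretive L := fun f => by
    obtain ⟨c, hc, hle⟩ := hcoercive
    rw [hLdef, ContinuousLinearMap.comp_apply, ContinuousLinearMap.comp_apply,
      ← ContinuousLinearMap.adjoint_inner_left]
    exact (by positivity : 0 ≤ c * ‖(P†) f‖ ^ 2).trans (hle _)
  rw [(hL.sqrtOp hLacc).domain_eq]
  refine range_eq_range_of_comp_adjoint_eq hcoercive ?_
  rw [hLacc.adjoint_accretiveSqrt, hLself]
  exact hLacc.accretiveSqrt_mul_self

end RangeOfSquareRoots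

section RelativeBounds

theorem bddAbove_range_div_iff {α : Type*} [Zero α] {a b : α → ℝ} (ha : a 0 = 0) (hb : b 0 = 0)
    (hpos : ∀ x, x ≠ 0 → 0 < b x) :
    BddAbove (Set.range fun x : {x : α // x ≠ 0} => a x / b x) ↔ ∃ c : ℝ, ∀ x, a x ≤ c * b x := by
  constructor
  · rintro ⟨c, hc⟩
    refine ⟨c, fun x => ?_⟩
    rcases eq_or_ne x 0 with rfl | hx
    · rw [ha, hb, mul_zero]
    · exact (div_le_iff₀ (hpos x hx)).mp (hc ⟨⟨x, hx⟩, rfl⟩)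
  · rintro ⟨c, hc⟩
    refine ⟨c, ?_⟩
    rintro _ ⟨⟨x, hx⟩, rfl⟩
    exact (div_le_iff₀ (hpos x hx)).mpr (hc x)

theorem norm_lt_one_iff_exists_norm_sq_le {𝕜 E F G : Type*} [RCLike 𝕜] [NormedAddCommGroup E]
    [NormedSpace 𝕜 E] [NormedAddCommGroup F] [NormedSpace 𝕜 F] [NormedAddCommGroup G]
    [NormedSpace 𝕜 G] {R : E →L[𝕜] F} (hR : DenseRange R) {T : F →L[𝕜] G} (hT : ‖T‖ ≤ 1) :
    ‖T‖ < 1 ↔ ∃ c : ℝ, ∀ f, ‖R f‖ ^ 2 ≤ c * (‖R f‖ ^ 2 - ‖T (R f)‖ ^ 2) := by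
  constructor
  · intro hlt
    have hpos : 0 < 1 - ‖T‖ ^ 2 := sub_pos.mpr (pow_lt_one₀ (norm_nonneg T) hlt two_ne_zero)
    refine ⟨(1 - ‖T‖ ^ 2)⁻¹, fun f => ?_⟩
    have hTf : ‖T (R f)‖ ^ 2 ≤ (‖T‖ * ‖R f‖) ^ 2 := by gcongr; exact T.le_opNorm _
    rw [le_inv_mul_iff₀ hpos]
    linarith
  · rintro ⟨c, hc⟩
    have hcx : ∀ x, ‖x‖ ^ 2 ≤ c * (‖x‖ ^ 2 - ‖T x‖ ^ 2) := fun x =>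
      hR.induction_on (p := fun x => ‖x‖ ^ 2 ≤ c * (‖x‖ ^ 2 - ‖T x‖ ^ 2)) x
        (isClosed_le (by fun_prop) (by fun_prop)) hc
    have hd : 0 < max c 1 := lt_max_of_lt_right one_pos
    have hsqrt : ‖T‖ ≤ √(1 - (max c 1)⁻¹) := T.opNorm_le_bound (Real.sqrt_nonneg _) fun x => by
      have hTx : ‖T x‖ ^ 2 ≤ ‖x‖ ^ 2 := by
        gcongr
        exact (T.le_of_opNorm_le hT x).trans_eq (one_mul _)
      have hdx : (max c 1)⁻¹ * ‖x‖ ^ 2 ≤ ‖x‖ ^ 2 - ‖T x‖ ^ 2 := by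
        rw [inv_mul_le_iff₀ hd]
        exact (hcx x).trans (mul_le_mul_of_nonneg_right (le_max_left c 1) (sub_nonneg.mpr hTx))
      refine le_of_sq_le_sq ?_ (by positivity)
      rw [mul_pow, Real.sq_sqrt (sub_nonneg.mpr (inv_le_one_of_one_le₀ (le_max_right c 1)))]
      linarith
    refine hsqrt.trans_lt ((Real.sqrt_lt' one_pos).mpr ?_)
    linarith [inv_pos.mpr hd]

end RelativeBounds

section RealSquareRoots

variable {H : Type*} [NormedAddCommGroup H] [InnerProductSpace ℂ H] {K P Q S Z : H →L[ℂ] H} {k : ℝ}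

/-- The form `(K f, g)` of a bounded operator. -/
def opForm (K : H →L[ℂ] H) : H →ₗ[ℂ] H →ₗ⋆[ℂ] ℂ := (innerₛₗ ℂ (E := H)).flip.comp K.toLinearMap

theorem opForm_apply (K : H →L[ℂ] H) (f g : H) : opForm K f g = ⟪g, K f⟫_ℂ := rfl

theorem IsBoundedInverse.exists_isSectorialForm {B : H →ₗ.[ℂ] H} (h : IsBoundedInverse B K)
    (hB : IsMSectorial B) : ∃ k, IsSectorialForm (opForm K) k := by
  obtain ⟨⟨hacc, -⟩, α, -, -, him⟩ := hB
  refine ⟨Real.tan α, fun f => ?_⟩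
  obtain ⟨u, hu, rfl⟩ := (LinearPMap.mem_graph_iff _).mp (h.1 f)
  rw [opForm_apply, h.2, ← inner_conj_symm, Complex.conj_re, Complex.conj_im, abs_neg]
  exact ⟨hacc u, him u⟩

variable [CompleteSpace H]

/-- `P` is a selfadjoint square root of `Re K`. -/
structure IsReSqrt (K P : H →L[ℂ] H) : Prop where
  isSelfAdjoint : IsSelfAdjoint P
  mul_self : P * P = reOp K

theorem IsBoundedAccretive.isReSqrt_sqrt (hK : IsBoundedAccretive K) :
    IsReSqrt K (CFC.sqrt (reOp K)) := by
  have hpos : 0 ≤ reOp K := by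
    rw [ContinuousLinearMap.nonneg_iff_isPositive, ContinuousLinearMap.isPositive_def']
    refine ⟨isSelfAdjoint_reOp K, fun f => ?_⟩
    rw [ContinuousLinearMap.reApplyInnerSelf_apply, inner_re_symm]
    exact (hK f).trans_eq (re_inner_reOp K f).symm
  exact ⟨(CFC.sqrt_nonneg _).isSelfAdjoint, CFC.sqrt_mul_sqrt_self _ hpos⟩

theorem range_adjoint_le_of_range_le (hP : IsSelfAdjoint P) (hS : Function.Injective S)
    (hSP : S * S = P * (Q * P)) (hle : P.range ≤ S.range) : (S†).range ≤ P.range := by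
  obtain ⟨X, hX⟩ := exists_eq_comp_of_injective_of_range_le hS hle
  have hSX : S = X * (Q * P) := by
    ext f
    refine hS ((DFunLike.congr_fun hSP f).trans ?_)
    rw [mul_apply_eq_comp]
    exact DFunLike.congr_fun hX _
  have hSadj : S† = P * (X * Q)† := by
    rw [hSX, ← mul_assoc, ← ContinuousLinearMap.star_eq_adjoint, star_mul, hP.star_eq,
      ContinuousLinearMap.star_eq_adjoint]
  rw [hSadj]
  exact LinearMap.range_comp_le_range _ _

namespace IsReSqrt

theorem norm_sq (hP : IsReSqrt K P) (f : H) : ‖P f‖ ^ 2 = (⟪f, K f⟫_ℂ).re := by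
  rw [← re_inner_reOp, ← hP.mul_self, mul_apply_eq_comp,
    ← ContinuousLinearMap.adjoint_inner_left, hP.isSelfAdjoint.adjoint_eq]
  exact (inner_self_eq_norm_sq (𝕜 := ℂ) _).symm

theorem norm_inner_le (hP : IsReSqrt K P) (hK : IsSectorialForm (opForm K) k) (f g : H) :
    ‖⟪g, K f⟫_ℂ‖ ≤ 2 * |1 + k| * ‖P f‖ * ‖P g‖ := by
  have h := hK.norm_le f g
  simp only [opForm_apply, ← hP.norm_sq, Real.sqrt_sq (norm_nonneg _), ← mul_assoc] at h
  exact h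

theorem injective (hP : IsReSqrt K P) (hK : IsSectorialForm (opForm K) k)
    (hinj : Function.Injective K) : Function.Injective P :=
  (injective_iff_map_eq_zero P).mpr fun f hf => by
    have h := hP.norm_inner_le hK f (K f)
    rw [hf, norm_zero, mul_zero, zero_mul, norm_le_zero_iff, inner_self_eq_zero] at h
    exact hinj (h.trans (map_zero K).symm)

theorem re_inner_pos (hP : IsReSqrt K P) (hK : IsSectorialForm (opForm K) k)
    (hinj : Function.Injective K) (f : H) (hf : f ≠ 0) : 0 < (⟪f, K f⟫_ℂ).re := by
  rw [← hP.norm_sq]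
  exact pow_pos (norm_pos_iff.mpr ((map_ne_zero_iff P (hP.injective hK hinj)).mpr hf)) 2

theorem exists_eq_mul_mul (hP : IsReSqrt K P) (hK : IsSectorialForm (opForm K) k)
    (hinj : Function.Injective K) : ∃ Q, IsCoerciveOp Q ∧ K = P * (Q * P) := by
  have hdense : DenseRange P := denseRange_of_injective_adjoint
    (by rw [hP.isSelfAdjoint.adjoint_eq]; exact hP.injective hK hinj)
  obtain ⟨Q, hQ⟩ := exists_eq_adjoint_comp_comp hdense (by positivity) (hP.norm_inner_le hK)
  refine ⟨Q, ⟨1, one_pos, fun x => ?_⟩, by rwa [hP.isSelfAdjoint.adjoint_eq] at hQ⟩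
  refine hdense.induction_on (p := fun x => 1 * ‖x‖ ^ 2 ≤ (⟪x, Q x⟫_ℂ).re) x
    (isClosed_le (by fun_prop) (by fun_prop)) fun f => ?_
  rw [one_mul, hP.norm_sq, hQ, ContinuousLinearMap.comp_apply,
    ContinuousLinearMap.adjoint_inner_right]
  rfl

theorem sqrtOp_realPartOp_domain {B : H →ₗ.[ℂ] H} (hP : IsReSqrt K P)
    (hK : IsSectorialForm (opForm K) k) (h : IsBoundedInverse B K) :
    (sqrtOp (realPartOp B)).domain = P.range := by
  obtain ⟨Q, hQ, rfl⟩ := hP.exists_eq_mul_mul hK h.injective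
  have hinj : Function.Injective P := hP.injective hK h.injective
  refine KatoSquareRoot.sqrtOp_realPartOp_domain hinj ?_ hQ ?_ <;>
    rwa [hP.isSelfAdjoint.adjoint_eq]

theorem range_le_range_reOp (hP : IsReSqrt (S * S) P) : P.range ≤ (reOp S).range := by
  refine range_le_range_iff_exists_norm_adjoint_le.mpr ⟨1, fun f => ?_⟩
  rw [hP.isSelfAdjoint.adjoint_eq, (isSelfAdjoint_reOp S).adjoint_eq, one_mul]
  refine le_of_sq_le_sq ?_ (norm_nonneg _)
  rw [hP.norm_sq, re_inner_mul_self]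
  exact sub_le_self _ (sq_nonneg _)

theorem range_reOp_eq_iff (hP : IsReSqrt (S * S) P) :
    (reOp S).range = P.range ↔ ∃ c : ℝ, ∀ f, ‖reOp S f‖ ^ 2 ≤ c * (⟪f, (S * S) f⟫_ℂ).re := by
  rw [le_antisymm_iff, and_iff_left hP.range_le_range_reOp,
    range_le_range_iff_exists_norm_adjoint_le, hP.isSelfAdjoint.adjoint_eq,
    (isSelfAdjoint_reOp S).adjoint_eq]
  simp only [← hP.norm_sq]
  constructor
  · rintro ⟨c, hc⟩
    refine ⟨c ^ 2, fun f => ?_⟩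
    rw [← mul_pow]
    exact pow_le_pow_left₀ (norm_nonneg _) (hc f) 2
  · rintro ⟨c, hc⟩
    refine ⟨√(max c 0), fun f => le_of_sq_le_sq ?_ (by positivity)⟩
    rw [mul_pow, Real.sq_sqrt (le_max_right c 0)]
    exact (hc f).trans (mul_le_mul_of_nonneg_right (le_max_left c 0) (sq_nonneg _))

end IsReSqrt

namespace IsReImQuotient

theorem norm_adjoint_apply_reOp (h : IsReImQuotient S Z) (f : H) :
    ‖(Z†) (reOp S f)‖ = ‖imOp S f‖ := by
  have hadj := congrArg star h.reOp_mul
  rw [star_mul, star_smul, (isSelfAdjoint_imOp S).star_eq, (isSelfAdjoint_reOp S).star_eq] at hadj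
  rw [← ContinuousLinearMap.star_eq_adjoint, ← mul_apply_eq_comp, hadj, smul_apply, norm_smul,
    norm_star, Complex.norm_I, one_mul]

theorem norm_lt_one_iff (h : IsReImQuotient S Z) :
    ‖Z‖ < 1 ↔ ∃ c : ℝ, ∀ f, ‖reOp S f‖ ^ 2 ≤ c * (⟪f, (S * S) f⟫_ℂ).re := by
  have hdense : DenseRange (reOp S) := denseRange_of_injective_adjoint
    (by rw [(isSelfAdjoint_reOp S).adjoint_eq]; exact h.injective_reOp)
  have hnorm : ‖Z†‖ = ‖Z‖ := LinearIsometryEquiv.norm_map _ _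
  rw [← hnorm, norm_lt_one_iff_exists_norm_sq_le hdense (hnorm.trans_le h.norm_le)]
  simp only [h.norm_adjoint_apply_reOp, re_inner_mul_self]

theorem exists_norm_adjoint_sq_add_norm_sq_le_iff (h : IsReImQuotient S Z) :
    (∃ c : ℝ, ∀ f, ‖(S†) f‖ ^ 2 + ‖S f‖ ^ 2 ≤ c * (⟪f, (S * S) f⟫_ℂ).re) ↔
      ∃ c : ℝ, ∀ f, ‖reOp S f‖ ^ 2 ≤ c * (⟪f, (S * S) f⟫_ℂ).re := by
  simp only [norm_adjoint_sq_add_norm_sq]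
  constructor
  · rintro ⟨c, hc⟩
    exact ⟨c, fun f => by linarith [hc f, sq_nonneg ‖reOp S f‖, sq_nonneg ‖imOp S f‖]⟩
  · rintro ⟨c, hc⟩
    refine ⟨4 * c, fun f => ?_⟩
    have him : ‖imOp S f‖ ≤ ‖reOp S f‖ := by
      rw [← h.norm_adjoint_apply_reOp, ← one_mul ‖reOp S f‖]
      exact (Z†).le_of_opNorm_le ((LinearIsometryEquiv.norm_map _ _).trans_le h.norm_le) _
    linarith [hc f, pow_le_pow_left₀ (norm_nonneg _) him 2]

theorem range_eq_range_reOp (h : IsReImQuotient S Z) (hZ : ‖Z‖ < 1) :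
    S.range = (reOp S).range := by
  have hunit : IsUnit (1 + Z) := by
    have := (Units.oneSub (-Z) (by rwa [norm_neg])).isUnit
    rwa [Units.val_oneSub, sub_neg_eq_add] at this
  refine le_antisymm ?_ (h.range_one_add_eq_top_iff.mp
    (LinearMap.range_eq_top.mpr (ContinuousLinearMap.isUnit_iff_bijective.mp hunit).surjective))
  nth_rw 1 [← h.reOp_mul_one_add]
  exact LinearMap.range_comp_le_range _ _

end IsReImQuotient

theorem tfae_range_eq_range_adjoint_of_sectorial (h : IsReImQuotient S Z)
    (hS : Function.Injective S) (hS' : Function.Injective (S†)) (hP : IsReSqrt (S * S) P)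
    (hK : IsSectorialForm (opForm (S * S)) k) :
    List.TFAE [
      S.range = (S†).range,
      S.range = P.range,
      (S†).range = P.range,
      S.range ≤ P.range ∧ (S†).range ≤ P.range,
      P.range ≤ S.range ⊓ (S†).range,
      ‖Z‖ < 1,
      BddAbove (Set.range fun f : {f : H // f ≠ 0} =>
        ‖reOp S f‖ ^ 2 / (⟪(f : H), (S * S) f⟫_ℂ).re),
      BddAbove (Set.range fun f : {f : H // f ≠ 0} =>
        (‖(S†) f‖ ^ 2 + ‖S f‖ ^ 2) / (⟪(f : H), (S * S) f⟫_ℂ).re),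
      (reOp S).range = P.range] := by
  have hinj : Function.Injective (S * S) := hS.comp hS
  obtain ⟨Q, -, hQ⟩ := hP.exists_eq_mul_mul hK hinj
  have hQ' : S† * S† = P * (Q† * P) := by
    simpa only [← ContinuousLinearMap.star_eq_adjoint, star_mul, hP.isSelfAdjoint.star_eq,
      mul_assoc] using congrArg star hQ
  have hle : P.range ≤ S.range → (S†).range ≤ P.range :=
    range_adjoint_le_of_range_le hP.isSelfAdjoint hS hQ
  have hle' : P.range ≤ (S†).range → S.range ≤ P.range := by
    simpa only [ContinuousLinearMap.adjoint_adjoint] using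
      range_adjoint_le_of_range_le hP.isSelfAdjoint hS' hQ'
  have hre := hP.range_le_range_reOp
  have hpos := hP.re_inner_pos hK hinj
  tfae_have 1 → 5 := fun heq =>
    le_inf (hre.trans ((range_reOp_le_sup S).trans (sup_le le_rfl heq.ge)))
      (hre.trans ((range_reOp_le_sup S).trans (sup_le heq.le le_rfl)))
  tfae_have 2 → 4 := fun heq => ⟨heq.le, hle heq.ge⟩
  tfae_have 3 → 4 := fun heq => ⟨hle' heq.ge, heq.le⟩
  tfae_have 5 → 4 := fun h5 => ⟨hle' (h5.trans inf_le_right), hle (h5.trans inf_le_left)⟩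
  tfae_have 4 → 9 := fun h4 => le_antisymm ((range_reOp_le_sup S).trans (sup_le h4.1 h4.2)) hre
  tfae_have 6 ↔ 9 := h.norm_lt_one_iff.trans hP.range_reOp_eq_iff.symm
  tfae_have 7 ↔ 9 := (bddAbove_range_div_iff (a := fun f => ‖reOp S f‖ ^ 2)
    (b := fun f => (⟪f, (S * S) f⟫_ℂ).re) (by simp) (by simp) hpos).trans
    hP.range_reOp_eq_iff.symm
  tfae_have 8 ↔ 9 := (bddAbove_range_div_iff (a := fun f => ‖(S†) f‖ ^ 2 + ‖S f‖ ^ 2)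
    (b := fun f => (⟪f, (S * S) f⟫_ℂ).re) (by simp) (by simp) hpos).trans
    (h.exists_norm_adjoint_sq_add_norm_sq_le_iff.trans hP.range_reOp_eq_iff.symm)
  have hadj : ‖Z‖ < 1 → (S†).range = (reOp S).range := fun hZ => by
    simpa only [reOp_adjoint] using h.adjoint.range_eq_range_reOp ((norm_neg Z).trans_lt hZ)
  tfae_have 6 → 1 := fun hZ => (h.range_eq_range_reOp hZ).trans (hadj hZ).symm
  tfae_have 6 → 2 := fun hZ => (h.range_eq_range_reOp hZ).trans (tfae_6_iff_9.mp hZ)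
  tfae_have 6 → 3 := fun hZ => (hadj hZ).trans (tfae_6_iff_9.mp hZ)
  tfae_finish

end RealSquareRoots

end KatoSquareRoot

end

theorem mainTheorem1 {H : Type*} [NormedAddCommGroup H] [InnerProductSpace ℂ H] [CompleteSpace H]
    (B : H →ₗ.[ℂ] H) (hB : IsMAccretive B) (hunb : ¬ IsBoundedOp B)
    (hinv : HasBoundedInverse B) :
    List.TFAE [
      (sqrtOp B).domain = (sqrtOp B.adjoint).domain,
      IsBoundedOp (opMul (sqrtOp B) (ofBounded (invSqrt B.adjoint))) ∧
        HasBoundedInverse (opMul (sqrtOp B) (ofBounded (invSqrt B.adjoint))),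
      ran (idOp + opZ B) = ⊤ ∧ ran (idOp - opZ B) = ⊤,
      ran (idOp - opMul (opZ B) (opZ B)) = ⊤,
      (ofBounded (reOp (invSqrt B))).inverse.domain ≤
        (sqrtOp B).domain ⊓ (sqrtOp B.adjoint).domain] ∧
    (IsMSectorial B → List.TFAE [
      (sqrtOp B).domain = (sqrtOp B.adjoint).domain,
      (sqrtOp B).domain = (sqrtOp (realPartOp B)).domain,
      (sqrtOp B.adjoint).domain = (sqrtOp (realPartOp B)).domain,
      (sqrtOp B).domain ≤ (sqrtOp (realPartOp B)).domain ∧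
        (sqrtOp B.adjoint).domain ≤ (sqrtOp (realPartOp B)).domain,
      (sqrtOp (realPartOp B)).domain ≤ (sqrtOp B).domain ⊓ (sqrtOp B.adjoint).domain,
      opNorm (opZ B) < 1,
      BddAbove (Set.range fun f : {f : H // f ≠ 0} =>
        ‖reOp (invSqrt B) f‖ ^ 2 / (inner ℂ (f : H) (boundedInv B f)).re),
      BddAbove (Set.range fun f : {f : H // f ≠ 0} =>
        (‖invSqrt B.adjoint f‖ ^ 2 + ‖invSqrt B f‖ ^ 2) /
          (inner ℂ (f : H) (boundedInv B f)).re),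
      (ofBounded (reOp (invSqrt B))).inverse.domain =
        (ofBounded (CFC.sqrt (reOp (boundedInv B)))).inverse.domain]) := by
  obtain ⟨K, hK⟩ := hinv
  have hacc : IsBoundedAccretive K := hK.isBoundedAccretive hB.1
  obtain ⟨S, hS, hS', rfl⟩ : ∃ S, IsBoundedInverse (sqrtOp B) S ∧
      IsBoundedInverse (sqrtOp B.adjoint) S.adjoint ∧ S * S = K :=
    ⟨accretiveSqrt K, hK.sqrtOp hacc,
      hacc.adjoint_accretiveSqrt ▸ (hK.adjoint hB.2.1).sqrtOp hacc.adjoint,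
      hacc.accretiveSqrt_mul_self⟩
  have hinvSqrt : invSqrt B = S := hS.boundedInv_eq
  obtain ⟨Z, hZ⟩ := exists_isReImQuotient hS.injective hacc
  have hopZ : opZ B = ofBounded Z := opZ_eq_ofBounded (by rwa [hinvSqrt])
  have hid : (idOp : H →ₗ.[ℂ] H) = ofBounded 1 := rfl
  rw [hopZ, hinvSqrt, invSqrt, hS'.boundedInv_eq, hS.domain_eq, hS'.domain_eq, hid,
    hS.isBoundedOp_and_hasBoundedInverse_opMul_iff hS'.injective, inverse_ofBounded_domain,
    ofBounded_mul, ofBounded_add, ofBounded_sub, ofBounded_sub, ran_ofBounded, ran_ofBounded,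
    ran_ofBounded]
  refine ⟨tfae_range_eq_range_adjoint hZ hS.injective hS'.injective, fun hsec => ?_⟩
  obtain ⟨k, hk⟩ := hK.exists_isSectorialForm hsec
  have hP : IsReSqrt (S * S) (CFC.sqrt (reOp (S * S))) := hacc.isReSqrt_sqrt
  rw [hP.sqrtOp_realPartOp_domain hk hK, hK.boundedInv_eq, inverse_ofBounded_domain,
    opNorm_ofBounded, ← ofReal_norm, ENNReal.ofReal_lt_one]
  exact tfae_range_eq_range_adjoint_of_sectorial hZ hS.injective hS'.injective hP hk
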